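/- Let $\alpha\in[0,1)$, $\rho\in(\alpha,1)$ and $\theta\in(\alpha,\min\{\rho,1/2\})$. Let $W\colon(0,\infty)^2\to\mathbb{R}$ be continuous, symmetric and homogeneous of degree zero with $$0\le W(x,y)\le \Bigl(\frac{x}{y}\Bigr)^{\alpha}+\Bigl(\frac{y}{x}\Bigr)^{\alpha}\qquad (x,y>0),$$ and for $\varepsilon>0$ put $K_\varepsilon=2+\varepsilon W$. A *self-similar profile* for $K_\varepsilon$ is a function $f\in L^1_{\mathrm{loc}}((0,\infty))$, $f\ge 0$, $f\not\equiv0$, with $xf(x)\in L^1_{\mathrm{loc}}([0,\infty))$ and $\int_1^\infty x^\alpha f(x)\,dx<\infty$, such that for almost every $x>0$ $$x^{2}f(x)=(1-\rho)\int_{0}^{x}yf(y)\,dy+\int_{0}^{x}\int_{x-y}^{\infty}yK_\varepsilon(y,z)f(y)f(z)\,dz\,dy .$$ It is *normalised* if $$\int_0^R yf(y)\,dy\le\frac{\rho^2}{\Gamma(2-\rho)}R^{1-\rho}\ \text{ for all } R>0\quad\text{and}\quad \int_0^R yf(y)\,dy\sim\frac{\rho^2}{\Gamma(2-\rho)}R^{1-\rho}\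 \text{ as } R\to\infty .$$ Write $(\mathcal{T}f)(q)=\int_0^\infty e^{-qx}f(x)\,dx$ for $q\ge0$, and for $G\in C^2((0,\infty))\cap C([0,\infty))$ let $$\|G\|_{2,0,\theta}=\sup_{q>0}(1+q)^{\theta}|G(q)|+\sum_{\ell=1}^{2}\sup_{q>0}(1+q)^{\theta+\rho}q^{\ell-\rho}|G^{(\ell)}(q)| ,$$ and let $X^2_{0,\theta}$ be the set of all $G\in C^2((0,\infty))\cap C([0,\infty))$ with $\|G\|_{2,0,\theta}<\infty$. Then there exist $\varepsilon_0>0$ and $C>0$ such that for every $\varepsilon\in(0,\varepsilon_0]$ and every normalised self-similar profile $f$ for $K_\varepsilon$, the function $f$ is integrable on $(0,\infty)$ (so that $\mathcal{T}f$ is well defined on $[0,\infty)$) and $$\|\mathcal{T}f\|_{2,0,\theta}<C .$$ In particular $\mathcal{T}f\in X^2_{0,\theta}$. -/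

import Mathlib

open MeasureTheory Set Filter

open scoped ENNReal

noncomputable section

namespace Coagulation

/-- Admissible perturbations of the constant kernel: `W` is a continuous, symmetric function on
`(0,∞) × (0,∞)`, homogeneous of degree zero, with `0 ≤ W(x,y) ≤ (x/y)^α + (y/x)^α`.
Only the values of `W` at positive arguments matter. -/
structure IsPerturbation (α : ℝ) (W : ℝ → ℝ → ℝ) : Prop where
  continuousOn : ContinuousOn (fun p : ℝ × ℝ => W p.1 p.2) (Ioi 0 ×ˢ Ioi 0)
  symm : ∀ x y : ℝ, 0 < x → 0 < y → W x y = W y x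
  homogeneous : ∀ c x y : ℝ, 0 < c → 0 < x → 0 < y → W (c * x) (c * y) = W x y
  nonneg : ∀ x y : ℝ, 0 < x → 0 < y → 0 ≤ W x y
  le : ∀ x y : ℝ, 0 < x → 0 < y → W x y ≤ (x / y) ^ α + (y / x) ^ α

/-- The coagulation kernel `K = 2 + ε W`. -/
def kernel (ε : ℝ) (W : ℝ → ℝ → ℝ) (x y : ℝ) : ℝ := 2 + ε * W x y

/-- The self-similar equation at the point `x`,
`x² f(x) = (1-ρ) ∫_0^x y f(y) dy + ∫_0^x ∫_{x-y}^∞ y K(y,z) f(y) f(z) dz dy`.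
For `f ≥ 0` and `K ≥ 0` all integrands are non-negative, so the integrals are taken in `[0,∞]`;
as the left-hand side is finite, the equation contains the finiteness of both integrals. -/
def SelfSimilarEqAt (ρ : ℝ) (K : ℝ → ℝ → ℝ) (f : ℝ → ℝ) (x : ℝ) : Prop :=
  ENNReal.ofReal (x ^ 2 * f x) =
    ENNReal.ofReal (1 - ρ) * (∫⁻ y in Ioo 0 x, ENNReal.ofReal (y * f y)) +
      ∫⁻ y in Ioo 0 x, ∫⁻ z in Ioi (x - y), ENNReal.ofReal (y * K y z * f y * f z)

/-- Self-similar profiles. A function on `(0,∞)` is represented by `f : ℝ → ℝ`, of which only the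
values on `(0,∞)` matter, up to null sets. -/
structure IsProfile (α ρ : ℝ) (K : ℝ → ℝ → ℝ) (f : ℝ → ℝ) : Prop where
  locallyIntegrable : LocallyIntegrableOn f (Ioi 0)
  nonneg : ∀ᵐ x ∂(volume.restrict (Ioi (0 : ℝ))), 0 ≤ f x
  ne_zero : ¬ (∀ᵐ x ∂(volume.restrict (Ioi (0 : ℝ))), f x = 0)
  equation : ∀ᵐ x ∂(volume.restrict (Ioi (0 : ℝ))), SelfSimilarEqAt ρ K f x
  locallyIntegrable_mul : LocallyIntegrableOn (fun x => x * f x) (Ici 0)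
  integrable_tail : IntegrableOn (fun x => x ^ α * f x) (Ioi 1)

/-- The normalisation of the tail: `∫_0^R y f(y) dy ≤ ρ²/Γ(2-ρ) R^(1-ρ)` for all `R > 0`, with
asymptotic equivalence as `R → ∞`. -/
structure IsNormalised (ρ : ℝ) (f : ℝ → ℝ) : Prop where
  le : ∀ R : ℝ, 0 < R →
    ∫ y in Ioc 0 R, y * f y ≤ ρ ^ 2 / Real.Gamma (2 - ρ) * R ^ (1 - ρ)
  isEquivalent : Asymptotics.IsEquivalent atTop (fun R : ℝ => ∫ y in Ioc 0 R, y * f y)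
    (fun R : ℝ => ρ ^ 2 / Real.Gamma (2 - ρ) * R ^ (1 - ρ))

/-- The Laplace transform `(T f)(q) = ∫_0^∞ e^{-q x} f(x) dx` of (the measure with density) `f`;
it is meaningful for all `q ≥ 0` when `f` is integrable on `(0,∞)`. -/
def laplace (f : ℝ → ℝ) (q : ℝ) : ℝ := ∫ x in Ioi 0, Real.exp (-q * x) * f x

/-- `⟦G⟧_{k,μ,χ} = sup_{q>0} (1+q)^(χ+μ+ρ) q^(k-ρ-μ) |G^(k)(q)|`, with values in `[0,∞]`. -/
def lsnorm (ρ : ℝ) (k : ℕ) (μ χ : ℝ) (G : ℝ → ℝ) : ℝ≥0∞ :=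
  ⨆ (q : ℝ) (_ : 0 < q),
    ENNReal.ofReal ((1 + q) ^ (χ + μ + ρ) * q ^ ((k : ℝ) - ρ - μ) * |iteratedDeriv k G q|)

/-- `‖G‖_{0,μ,χ} = ⟦G⟧_{0,μ,χ}`, and `‖G‖_{k,μ,χ} = ‖G‖_{0,-ρ,χ} + ∑_{ℓ=1}^k ⟦G⟧_{ℓ,μ,χ}`
for `k ≥ 1`, with values in `[0,∞]`. -/
def lfnorm (ρ : ℝ) (k : ℕ) (μ χ : ℝ) (G : ℝ → ℝ) : ℝ≥0∞ :=
  if k = 0 then lsnorm ρ 0 μ χ G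
  else lsnorm ρ 0 (-ρ) χ G + ∑ l ∈ Finset.Icc 1 k, lsnorm ρ l μ χ G

/-- The space `X^k_{μ,χ}` of functions in `C^k((0,∞)) ∩ C([0,∞))` with finite norm. -/
def spaceX (ρ : ℝ) (k : ℕ) (μ χ : ℝ) : Set (ℝ → ℝ) :=
  {G | ContDiffOn ℝ k G (Ioi 0) ∧ ContinuousOn G (Ici 0) ∧ lfnorm ρ k μ χ G < ∞}

end Coagulation

end

open scoped Topology

namespace Coagulation

/-! Let `μ` be the measure with density f and U(q) = ∫ (1 - e^{-qx}) dμ. This function makes sense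
before f is known to be integrable: by a layer-cake formula the bound on the first moment gives U' ≤
ρ² q^(ρ-1), hence U ≤ ρ q^ρ. Testing the self-similar equation with e^{-qx} and using Tonelli turns
it into -qU'' = (1-ρ)U' + 2UU' + E, where E ≥ 0 is the contribution of εW. This has a first integral
up to the defect: H = qU' - ρU + U² satisfies H' = -E and H(0+) = 0.

The sign of E alone already gives much. Since H ≤ 0 and U' ≥ 0, U ≤ ρ, and monotone convergence
bounds the mass A of `μ` by ρ (`HasTail.measure_univ_le`), so f is integrable and its Laplace
transform is A - U. Moreover H decreases to A² - ρA at infinity, that is, qU' ≥ (A-U)(A+U-ρ). Once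
U(q₀) ≥ (ρ+θ)/2 at a single point q₀, the last factor is at least θ beyond q₀, and (A-U)q^θ is
nonincreasing there (`IsRiccati.sub_le`).

Smallness of ε is therefore needed only at one point q₀ determined by ρ and θ. With the mass bound
in hand, E ≤ ε c q^(ρ+κ-1) with κ = ρ(1-α) and c depending only on α and ρ (`HasTail.defect_le`).
Comparison with ρq^ρ/(1+q^ρ), the solution for the constant kernel, for which H = 0, then gives
U(q₀) ≥ ρq₀^ρ/(1+q₀^ρ) - O(ε) (`IsRiccati.explicit_le`), and the main term tends to ρ as q₀ grows.

Decay passes to derivatives at the cost of constants, because x e^{-qx} ≤ (2/q) e^{-qx/2}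
(`HasTail.mom_succ_le`); near q = 0 the derivatives are controlled by the tail bound instead
(`HasTail.lfnorm_le`). -/

lemma lintegral_exp_Ioi {q : ℝ} (hq : 0 < q) (y : ℝ) :
    ∫⁻ x in Ioi y, ENNReal.ofReal (Real.exp (-q * x)) = ENNReal.ofReal (Real.exp (-q * y) / q) := by
  rw [← ofReal_integral_eq_lintegral_ofReal (integrableOn_exp_mul_Ioi (by linarith) y)
    (ae_of_all _ fun x => (Real.exp_pos _).le), integral_exp_mul_Ioi (by linarith)]
  congr 1
  field_simp

lemma lintegral_exp_Ioo {q : ℝ} (hq : q ≠ 0) {a b : ℝ} (hab : a ≤ b) :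
    ∫⁻ x in Ioo a b, ENNReal.ofReal (Real.exp (-q * x)) =
      ENNReal.ofReal ((Real.exp (-q * a) - Real.exp (-q * b)) / q) := by
  have hc : Continuous fun x : ℝ => Real.exp (-q * x) := by fun_prop
  rw [← ofReal_integral_eq_lintegral_ofReal
    ((hc.integrableOn_Icc (a := a) (b := b)).mono_set Ioo_subset_Icc_self)
    (ae_of_all _ fun x => (Real.exp_pos _).le), ← integral_Ioc_eq_integral_Ioo,
    ← intervalIntegral.integral_of_le hab]
  congr 1
  rw [intervalIntegral.integral_eq_sub_of_hasDerivAt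
    (f := fun x => -(Real.exp (-q * x) / q)) (fun x _ => ?_) (hc.intervalIntegrable _ _)]
  · ring
  · have := (((hasDerivAt_id x).const_mul (-q)).exp.div_const q).neg
    refine this.congr_deriv ?_
    simp only [id]
    field_simp

/-! ### Tonelli identities for Laplace transforms. -/

variable {μ : Measure ℝ}

/-- Layer-cake formula for the Laplace transform of the first moment. -/
lemma lintegral_mul_exp_eq [SFinite μ] (hpos : ∀ᵐ x ∂μ, 0 < x) {q : ℝ} (hq : 0 < q) :
    ∫⁻ x, ENNReal.ofReal (x * Real.exp (-q * x)) ∂μ =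
      ∫⁻ r in Ioi 0, ENNReal.ofReal (q * Real.exp (-q * r)) *
        ∫⁻ x in Ioc 0 r, ENNReal.ofReal x ∂μ := by
  let G : ℝ → ℝ → ℝ≥0∞ := fun r x =>
    {p : ℝ × ℝ | 0 < p.2 ∧ p.2 ≤ p.1}.indicator
      (fun p => ENNReal.ofReal (q * Real.exp (-q * p.1)) * ENNReal.ofReal p.2) (r, x)
  have hS : MeasurableSet {p : ℝ × ℝ | 0 < p.2 ∧ p.2 ≤ p.1} :=
    (measurableSet_lt measurable_const measurable_snd).inter
      (measurableSet_le measurable_snd measurable_fst)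
  have hG : Measurable (Function.uncurry G) :=
    Measurable.indicator (by fun_prop) hS
  have h1 : ∀ r : ℝ, ∫⁻ x, G r x ∂μ = ENNReal.ofReal (q * Real.exp (-q * r)) *
        ∫⁻ x in Ioc 0 r, ENNReal.ofReal x ∂μ := by
    intro r
    rw [← lintegral_const_mul _ (by fun_prop), ← lintegral_indicator measurableSet_Ioc]
    rfl
  have h2 : ∀ x : ℝ, 0 < x → ∫⁻ r in Ioi 0, G r x = ENNReal.ofReal (x * Real.exp (-q * x)) := by
    intro x hx
    have : ∀ r, G r x = (Ici x).indicator
        (fun r => ENNReal.ofReal (x * q) * ENNReal.ofReal (Real.exp (-q * r))) r := by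
      intro r
      simp only [G, indicator, mem_ofPred_eq, hx, true_and, mem_Ici]
      split_ifs
      · rw [← ENNReal.ofReal_mul (by positivity), ← ENNReal.ofReal_mul (by positivity)]
        congr 1; ring
      · rfl
    simp_rw [this]
    rw [setLIntegral_indicator measurableSet_Ici, inter_eq_left.2 (Ici_subset_Ioi.2 hx),
      lintegral_const_mul _ (by fun_prop), setLIntegral_congr Ioi_ae_eq_Ici.symm,
      lintegral_exp_Ioi hq, ← ENNReal.ofReal_mul (by positivity)]
    congr 1
    field_simp
  simp_rw [← h1]
  rw [lintegral_lintegral_swap hG.aemeasurable]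
  refine lintegral_congr_ae ?_
  filter_upwards [hpos] with x hx
  rw [h2 x hx]

/-- Tonelli for the first moment term of the self-similar equation. -/
lemma lintegral_exp_mul_lintegral_Ioo [SFinite μ] (hpos : ∀ᵐ x ∂μ, 0 < x) {q : ℝ} (hq : 0 < q) :
    ∫⁻ x in Ioi 0, ENNReal.ofReal (Real.exp (-q * x)) *
        ∫⁻ y in Ioo 0 x, ENNReal.ofReal y ∂μ =
      ENNReal.ofReal q⁻¹ * ∫⁻ x, ENNReal.ofReal (x * Real.exp (-q * x)) ∂μ := by
  let G : ℝ → ℝ → ℝ≥0∞ := fun r x =>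
    {p : ℝ × ℝ | 0 < p.2 ∧ p.2 < p.1}.indicator
      (fun p => ENNReal.ofReal (Real.exp (-q * p.1)) * ENNReal.ofReal p.2) (r, x)
  have hS : MeasurableSet {p : ℝ × ℝ | 0 < p.2 ∧ p.2 < p.1} :=
    (measurableSet_lt measurable_const measurable_snd).inter
      (measurableSet_lt measurable_snd measurable_fst)
  have hG : Measurable (Function.uncurry G) :=
    Measurable.indicator (by fun_prop) hS
  have h1 : ∀ r : ℝ, ∫⁻ x, G r x ∂μ = ENNReal.ofReal (Real.exp (-q * r)) *
        ∫⁻ x in Ioo 0 r, ENNReal.ofReal x ∂μ := by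
    intro r
    rw [← lintegral_const_mul _ (by fun_prop), ← lintegral_indicator measurableSet_Ioo]
    rfl
  have h2 : ∀ x : ℝ, 0 < x → ∫⁻ r in Ioi 0, G r x =
      ENNReal.ofReal q⁻¹ * ENNReal.ofReal (x * Real.exp (-q * x)) := by
    intro x hx
    have : ∀ r, G r x = (Ioi x).indicator
        (fun r => ENNReal.ofReal x * ENNReal.ofReal (Real.exp (-q * r))) r := by
      intro r
      simp only [G, indicator, mem_ofPred_eq, hx, true_and, mem_Ioi]
      split_ifs
      · rw [mul_comm]
      · rfl
    simp_rw [this]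
    rw [setLIntegral_indicator measurableSet_Ioi, inter_eq_left.2 (Ioi_subset_Ioi hx.le),
      lintegral_const_mul _ (by fun_prop),
      lintegral_exp_Ioi hq, ← ENNReal.ofReal_mul hx.le, ← ENNReal.ofReal_mul (by positivity)]
    congr 1
    field_simp
  simp_rw [← h1]
  rw [lintegral_lintegral_swap hG.aemeasurable, ← lintegral_const_mul _ (by fun_prop)]
  refine lintegral_congr_ae ?_
  filter_upwards [hpos] with x hx
  rw [h2 x hx]

/-- Tonelli for the coagulation flux in the self-similar equation. -/
lemma lintegral_exp_mul_flux [SFinite μ] (hpos : ∀ᵐ x ∂μ, 0 < x) {q : ℝ} (hq : 0 < q)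
    {k : ℝ → ℝ → ℝ≥0∞} (hk : Measurable (Function.uncurry k)) :
    ∫⁻ x in Ioi 0, ENNReal.ofReal (Real.exp (-q * x)) *
        ∫⁻ y in Ioo 0 x, ∫⁻ z in Ioi (x - y), k y z ∂μ ∂μ =
      ENNReal.ofReal q⁻¹ * ∫⁻ y, ∫⁻ z, k y z *
        ENNReal.ofReal (Real.exp (-q * y) * (1 - Real.exp (-q * z))) ∂μ ∂μ := by
  let S : Set (ℝ × ℝ × ℝ) := {p | (0 < p.2.1 ∧ p.2.1 < p.1) ∧ p.1 - p.2.1 < p.2.2}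
  have hS : MeasurableSet S :=
    ((measurableSet_lt measurable_const measurable_snd.fst).inter
      (measurableSet_lt measurable_snd.fst measurable_fst)).inter
      (measurableSet_lt (measurable_fst.sub measurable_snd.fst) measurable_snd.snd)
  let G : ℝ → ℝ × ℝ → ℝ≥0∞ := fun x p => S.indicator
      (fun p => ENNReal.ofReal (Real.exp (-q * p.1)) * k p.2.1 p.2.2) (x, p)
  have hk' : ∀ y, Measurable (k y) := fun y => hk.comp measurable_prodMk_left
  have hkS : Measurable fun p : ℝ × ℝ × ℝ => k p.2.1 p.2.2 := hk.comp measurable_snd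
  have hG : Measurable (Function.uncurry G) :=
    Measurable.indicator ((by fun_prop : Measurable fun p : ℝ × ℝ × ℝ =>
      ENNReal.ofReal (Real.exp (-q * p.1))).mul hkS) hS
  have h1 : ∀ x : ℝ, ∫⁻ p, G x p ∂(μ.prod μ) = ENNReal.ofReal (Real.exp (-q * x)) *
        ∫⁻ y in Ioo 0 x, ∫⁻ z in Ioi (x - y), k y z ∂μ ∂μ := by
    intro x
    have hGx : Measurable (G x) := hG.comp measurable_prodMk_left
    rw [lintegral_prod _ hGx.aemeasurable]
    have hin : ∀ y, ∫⁻ z, G x (y, z) ∂μ = (Ioo 0 x).indicator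
        (fun y => ENNReal.ofReal (Real.exp (-q * x)) * ∫⁻ z in Ioi (x - y), k y z ∂μ) y := by
      intro y
      by_cases hy : y ∈ Ioo 0 x
      · rw [indicator_of_mem hy, ← lintegral_const_mul _ (hk' y),
          ← lintegral_indicator measurableSet_Ioi]
        refine lintegral_congr fun z => ?_
        simp only [G, S, indicator, mem_ofPred_eq, hy.1, hy.2, true_and, mem_Ioi]
      · rw [indicator_of_notMem hy]
        refine (lintegral_congr fun z => ?_).trans lintegral_zero
        exact indicator_of_notMem (fun h => hy h.1) _
    simp_rw [hin]
    rw [lintegral_indicator measurableSet_Ioo, lintegral_const_mul' _ _ ENNReal.ofReal_ne_top]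
  have h2 : ∀ y z : ℝ, 0 < y → 0 < z → ∫⁻ x in Ioi 0, G x (y, z) =
      ENNReal.ofReal q⁻¹ * (k y z *
        ENNReal.ofReal (Real.exp (-q * y) * (1 - Real.exp (-q * z)))) := by
    intro y z hy hz
    -- For fixed y and z the constraints y < x and x - y < z leave x in (y, y+z), where e^{-qx}
    -- integrates to q⁻¹ e^{-qy}(1 - e^{-qz}).
    have : ∀ x, G x (y, z) = (Ioo y (y + z)).indicator
        (fun x => k y z * ENNReal.ofReal (Real.exp (-q * x))) x := by
      intro x
      simp only [G, S, indicator, mem_ofPred_eq, hy, true_and, mem_Ioo, sub_lt_iff_lt_add']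
      split_ifs
      · rw [mul_comm]
      · rfl
    simp_rw [this]
    rw [setLIntegral_indicator measurableSet_Ioo,
      inter_eq_left.2 (Ioo_subset_Ioi_self.trans (Ioi_subset_Ioi hy.le)),
      lintegral_const_mul _ (by fun_prop), lintegral_exp_Ioo hq.ne' (by linarith),
      mul_left_comm, ← ENNReal.ofReal_mul (by positivity)]
    congr 2
    rw [mul_add, Real.exp_add]
    field_simp
  simp_rw [← h1]
  rw [lintegral_lintegral_swap hG.aemeasurable,
    lintegral_prod _ (Measurable.lintegral_prod_left' (f := fun p : ℝ × ℝ × ℝ => G p.1 p.2)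
      hG).aemeasurable,
    ← lintegral_const_mul' _ _ ENNReal.ofReal_ne_top]
  refine lintegral_congr_ae ?_
  filter_upwards [hpos] with y hy
  rw [← lintegral_const_mul' _ _ ENNReal.ofReal_ne_top]
  refine lintegral_congr_ae ?_
  filter_upwards [hpos] with z hz
  rw [h2 y z hy hz]

/-- The Laplace representation `1 - e^{-qx} = ∫_0^q x e^{-sx} ds` and its weighted variants,
integrated against `μ`. -/
lemma lintegral_one_sub_exp_eq [SFinite μ] (hpos : ∀ᵐ x ∂μ, 0 < x) (q : ℝ) (hq : 0 < q)
    {h : ℝ → ℝ} (hh : Measurable h) (h0 : ∀ x, 0 < x → 0 ≤ h x) :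
    ∫⁻ x, ENNReal.ofReal (h x * (1 - Real.exp (-q * x))) ∂μ =
      ∫⁻ s in Ioo 0 q, ∫⁻ x, ENNReal.ofReal (h x * (x * Real.exp (-s * x))) ∂μ := by
  rw [lintegral_lintegral_swap (by fun_prop)]
  refine lintegral_congr_ae ?_
  filter_upwards [hpos] with x hx
  have : ∀ s, ENNReal.ofReal (h x * (x * Real.exp (-s * x))) =
      ENNReal.ofReal (h x * x) * ENNReal.ofReal (Real.exp (-x * s)) := by
    intro s
    rw [← ENNReal.ofReal_mul (mul_nonneg (h0 x hx) hx.le)]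
    congr 1
    rw [show -s * x = -x * s by ring]; ring
  simp_rw [this]
  rw [lintegral_const_mul _ (by fun_prop), lintegral_exp_Ioo hx.ne' hq.le,
    ← ENNReal.ofReal_mul (mul_nonneg (h0 x hx) hx.le)]
  congr 1
  rw [show -x * q = -q * x by ring]
  simp
  field_simp

lemma mul_exp_neg_le {s : ℝ} (hs : 0 < s) (x : ℝ) : x * Real.exp (-s * x) ≤ s⁻¹ := by
  have h : s * x ≤ Real.exp (s * x) := by linarith [Real.add_one_le_exp (s * x)]
  rw [neg_mul, Real.exp_neg, ← div_eq_mul_inv, div_le_iff₀ (Real.exp_pos _),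
    inv_mul_eq_div, le_div_iff₀ hs]
  linarith

lemma lintegral_rpow_Ioo {a C q : ℝ} (ha : 0 < a) (hC : 0 ≤ C) (hq : 0 < q) :
    ∫⁻ s in Ioo 0 q, ENNReal.ofReal (C * s ^ (a - 1)) = ENNReal.ofReal (C / a * q ^ a) := by
  have hi : IntervalIntegrable (fun s : ℝ => C * s ^ (a - 1)) volume 0 q :=
    (intervalIntegral.intervalIntegrable_rpow' (by linarith)).const_mul C
  have hi' := (intervalIntegrable_iff_integrableOn_Ioo_of_le hq.le).1 hi
  rw [← ofReal_integral_eq_lintegral_ofReal hi', ← integral_Ioc_eq_integral_Ioo,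
    ← intervalIntegral.integral_of_le hq.le, intervalIntegral.integral_const_mul,
    integral_rpow (Or.inl (by linarith))]
  · congr 1
    rw [sub_add_cancel, Real.zero_rpow ha.ne']
    ring
  · filter_upwards [ae_restrict_mem measurableSet_Ioo] with s hs
    exact mul_nonneg hC (Real.rpow_nonneg hs.1.le _)

/-- A Gamma integral: it converts growth r^(1-ρ) of the first moment into q^(ρ-1), and its factor
Γ(2-ρ) cancels the one in the normalisation, leaving ρ². -/
lemma lintegral_exp_mul_rpow {ρ c q : ℝ} (hρ : ρ < 1) (hc : 0 ≤ c) (hq : 0 < q) :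
    ∫⁻ r in Ioi 0, ENNReal.ofReal (q * Real.exp (-q * r)) * ENNReal.ofReal (c * r ^ (1 - ρ)) =
      ENNReal.ofReal (c * Real.Gamma (2 - ρ) * q ^ (ρ - 1)) := by
  have h := Real.integral_rpow_mul_exp_neg_mul_Ioi (a := 2 - ρ) (by linarith) hq
  have hG := Real.Gamma_pos_of_pos (show 0 < 2 - ρ by linarith)
  have hi : IntegrableOn (fun t : ℝ => t ^ (2 - ρ - 1) * Real.exp (-(q * t))) (Ioi 0) := by
    by_contra hcon
    rw [integral_undef hcon] at h
    have : 0 < (1 / q) ^ (2 - ρ) * Real.Gamma (2 - ρ) := by positivity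
    linarith
  have heq : ∫⁻ r in Ioi 0, ENNReal.ofReal (q * Real.exp (-q * r)) *
      ENNReal.ofReal (c * r ^ (1 - ρ)) = ∫⁻ r in Ioi 0, ENNReal.ofReal
        (q * c * (r ^ (2 - ρ - 1) * Real.exp (-(q * r)))) := by
    refine lintegral_congr fun r => ?_
    rw [← ENNReal.ofReal_mul (by positivity)]
    congr 1
    rw [show 2 - ρ - 1 = 1 - ρ by ring, neg_mul]; ring
  rw [heq, ← ofReal_integral_eq_lintegral_ofReal (hi.const_mul _), integral_const_mul, h]
  · congr 1
    rw [one_div, Real.inv_rpow hq.le, ← Real.rpow_neg hq.le,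
      show ρ - 1 = 1 + -(2 - ρ) by ring, Real.rpow_add hq, Real.rpow_one]
    ring
  · filter_upwards [ae_restrict_mem measurableSet_Ioi] with r hr
    have : (0 : ℝ) < r := hr
    positivity

/-! ### Moments and Bernstein function of a measure with prescribed tail. -/

/-- Measures on `(0,∞)` whose first moment is bounded by, and asymptotic to,
`ρ²/Γ(2-ρ) R^(1-ρ)`. -/
structure HasTail (ρ : ℝ) (μ : Measure ℝ) : Prop where
  pos : ∀ᵐ x ∂μ, 0 < x
  le : ∀ r : ℝ, 0 < r → ∫⁻ x in Ioc 0 r, ENNReal.ofReal x ∂μ ≤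
    ENNReal.ofReal (ρ ^ 2 / Real.Gamma (2 - ρ) * r ^ (1 - ρ))
  ge : ∀ η : ℝ, 0 < η → η < 1 → ∃ B : ℝ, 0 ≤ B ∧ ∀ r : ℝ, 0 < r →
    ENNReal.ofReal ((1 - η) * (ρ ^ 2 / Real.Gamma (2 - ρ)) * r ^ (1 - ρ)) ≤
      ∫⁻ x in Ioc 0 r, ENNReal.ofReal x ∂μ + ENNReal.ofReal B

/-- The Bernstein function `∫ (1 - e^{-qx}) dμ`. -/
noncomputable def bernstein (μ : Measure ℝ) (q : ℝ) : ℝ := ∫ x, (1 - Real.exp (-q * x)) ∂μ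

/-- The Laplace transform `∫ x^k e^{-qx} dμ` of the `k`-th moment. -/
noncomputable def mom (μ : Measure ℝ) (k : ℕ) (q : ℝ) : ℝ := ∫ x, x ^ k * Real.exp (-q * x) ∂μ

variable {μ : Measure ℝ} {ρ : ℝ}

lemma integrable_of_lintegral_le {g : ℝ → ℝ} (hg : AEStronglyMeasurable g μ) (h0 : 0 ≤ᵐ[μ] g)
    {b : ℝ} (h : ∫⁻ x, ENNReal.ofReal (g x) ∂μ ≤ ENNReal.ofReal b) : Integrable g μ :=
  (lintegral_ofReal_ne_top_iff_integrable hg h0).1 (ne_top_of_le_ne_top ENNReal.ofReal_ne_top h)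

lemma integral_le_of_lintegral_le {g : ℝ → ℝ} (hg : AEStronglyMeasurable g μ) (h0 : 0 ≤ᵐ[μ] g)
    {b : ℝ} (hb : 0 ≤ b) (h : ∫⁻ x, ENNReal.ofReal (g x) ∂μ ≤ ENNReal.ofReal b) :
    ∫ x, g x ∂μ ≤ b := by
  rw [← ofReal_integral_eq_lintegral_ofReal (integrable_of_lintegral_le hg h0 h) h0] at h
  exact (ENNReal.ofReal_le_ofReal_iff hb).1 h

lemma one_sub_exp_nonneg {q x : ℝ} (hq : 0 ≤ q) (hx : 0 ≤ x) : 0 ≤ 1 - Real.exp (-q * x) := by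
  have := Real.exp_le_one_iff.2 (show -q * x ≤ 0 by nlinarith)
  linarith

namespace HasTail

variable (h : HasTail ρ μ)
include h

lemma mom_integrand_nonneg (k : ℕ) (q : ℝ) : 0 ≤ᵐ[μ] fun x => x ^ k * Real.exp (-q * x) := by
  filter_upwards [h.pos] with x hx
  have : 0 < x := hx
  positivity

lemma mom_nonneg (k : ℕ) (q : ℝ) : 0 ≤ mom μ k q :=
  integral_nonneg_of_ae (h.mom_integrand_nonneg k q)

lemma bernstein_integrand_nonneg {q : ℝ} (hq : 0 ≤ q) :
    0 ≤ᵐ[μ] fun x => 1 - Real.exp (-q * x) := by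
  filter_upwards [h.pos] with x hx
  exact one_sub_exp_nonneg hq hx.le

variable [SFinite μ]

lemma lintegral_le (hρ₁ : ρ < 1) {q : ℝ} (hq : 0 < q) :
    ∫⁻ x, ENNReal.ofReal (x * Real.exp (-q * x)) ∂μ ≤ ENNReal.ofReal (ρ ^ 2 * q ^ (ρ - 1)) := by
  have hG := Real.Gamma_pos_of_pos (show 0 < 2 - ρ by linarith)
  rw [lintegral_mul_exp_eq h.pos hq]
  calc _ ≤ ∫⁻ r in Ioi 0, ENNReal.ofReal (q * Real.exp (-q * r)) *
        ENNReal.ofReal (ρ ^ 2 / Real.Gamma (2 - ρ) * r ^ (1 - ρ)) :=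
        setLIntegral_mono' measurableSet_Ioi fun r hr => mul_le_mul_right (h.le r hr) _
    _ = _ := by
        rw [lintegral_exp_mul_rpow hρ₁ (by positivity) hq]
        congr 2
        field_simp

/-- The density q e^{-qr} has mass one on (0,∞), so the additive constant survives the layer-cake
formula unchanged. `B` may depend on the measure; this is harmless because it serves only to
identify limits as q → 0. -/
lemma le_lintegral (hρ₁ : ρ < 1) {η : ℝ} (hη : 0 < η) (hη₁ : η < 1) :
    ∃ B : ℝ, 0 ≤ B ∧ ∀ q : ℝ, 0 < q → ENNReal.ofReal ((1 - η) * ρ ^ 2 * q ^ (ρ - 1)) ≤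
      ∫⁻ x, ENNReal.ofReal (x * Real.exp (-q * x)) ∂μ + ENNReal.ofReal B := by
  obtain ⟨B, hB, hge⟩ := h.ge η hη hη₁
  refine ⟨B, hB, fun q hq => ?_⟩
  have hG := Real.Gamma_pos_of_pos (show 0 < 2 - ρ by linarith)
  have h1η : 0 < 1 - η := by linarith
  have hone : ∫⁻ r in Ioi 0, ENNReal.ofReal (q * Real.exp (-q * r)) = 1 := by
    simp_rw [ENNReal.ofReal_mul hq.le]
    rw [lintegral_const_mul' _ _ ENNReal.ofReal_ne_top, lintegral_exp_Ioi hq,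
      ← ENNReal.ofReal_mul hq.le]
    simp [hq.ne']
  rw [lintegral_mul_exp_eq h.pos hq]
  calc _ = ∫⁻ r in Ioi 0, ENNReal.ofReal (q * Real.exp (-q * r)) *
        ENNReal.ofReal ((1 - η) * (ρ ^ 2 / Real.Gamma (2 - ρ)) * r ^ (1 - ρ)) := by
        rw [lintegral_exp_mul_rpow hρ₁ (by positivity) hq]
        congr 2
        field_simp
    _ ≤ ∫⁻ r in Ioi 0, (ENNReal.ofReal (q * Real.exp (-q * r)) *
          ∫⁻ x in Ioc 0 r, ENNReal.ofReal x ∂μ + ENNReal.ofReal (q * Real.exp (-q * r)) *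
            ENNReal.ofReal B) := by
        refine setLIntegral_mono' measurableSet_Ioi fun r hr => ?_
        rw [← mul_add]
        exact mul_le_mul_right (hge r hr) _
    _ = _ := by
        rw [lintegral_add_right _ (by fun_prop), lintegral_mul_const _ (by fun_prop), hone, one_mul]

/-- Integrating the first-moment bound over (0,q). This makes the Bernstein function finite without
any assumption on the total mass. -/
lemma lintegral_one_sub_exp_le (hρ : 0 < ρ) (hρ₁ : ρ < 1) {q : ℝ} (hq : 0 < q) :
    ∫⁻ x, ENNReal.ofReal (1 - Real.exp (-q * x)) ∂μ ≤ ENNReal.ofReal (ρ * q ^ ρ) := by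
  have := lintegral_one_sub_exp_eq h.pos q hq (h := fun _ => 1) measurable_const
    (fun _ _ => zero_le_one)
  simp only [one_mul] at this
  rw [this]
  calc _ ≤ ∫⁻ s in Ioo 0 q, ENNReal.ofReal (ρ ^ 2 * s ^ (ρ - 1)) :=
        setLIntegral_mono' measurableSet_Ioo fun s hs => h.lintegral_le hρ₁ hs.1
    _ = _ := by
        rw [lintegral_rpow_Ioo hρ (by positivity) hq]
        congr 2
        field_simp

lemma integrable_mom (hρ₁ : ρ < 1) (k : ℕ) {q : ℝ} (hq : 0 < q) :
    Integrable (fun x => x ^ (k + 1) * Real.exp (-q * x)) μ := by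
  induction k generalizing q with
  | zero =>
    have h0 := h.mom_integrand_nonneg 1 q
    simp only [zero_add, pow_one] at h0 ⊢
    exact integrable_of_lintegral_le (by fun_prop) h0 (h.lintegral_le hρ₁ hq)
  | succ k ih =>
    refine ((ih (half_pos hq)).const_mul (q / 2)⁻¹).mono' (by fun_prop) ?_
    filter_upwards [h.pos] with x hx
    have hx' : 0 < x := hx
    rw [Real.norm_of_nonneg (by positivity)]
    calc x ^ (k + 1 + 1) * Real.exp (-q * x)
        = (x * Real.exp (-(q / 2) * x)) * (x ^ (k + 1) * Real.exp (-(q / 2) * x)) := by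
          rw [show -q * x = -(q / 2) * x + -(q / 2) * x by ring, Real.exp_add]; ring
      _ ≤ _ := by gcongr; exact mul_exp_neg_le (half_pos hq) x

lemma integrable_bernstein (hρ : 0 < ρ) (hρ₁ : ρ < 1) {q : ℝ} (hq : 0 < q) :
    Integrable (fun x => 1 - Real.exp (-q * x)) μ :=
  integrable_of_lintegral_le (by fun_prop) (h.bernstein_integrand_nonneg hq.le)
    (h.lintegral_one_sub_exp_le hρ hρ₁ hq)

lemma mom_one_le (hρ₁ : ρ < 1) {q : ℝ} (hq : 0 < q) : mom μ 1 q ≤ ρ ^ 2 * q ^ (ρ - 1) := by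
  have h0 := h.mom_integrand_nonneg 1 q
  simp only [mom, pow_one] at h0 ⊢
  exact integral_le_of_lintegral_le (by fun_prop) h0 (by positivity) (h.lintegral_le hρ₁ hq)

lemma le_mom_one (hρ₁ : ρ < 1) {η : ℝ} (hη : 0 < η) (hη₁ : η < 1) :
    ∃ B : ℝ, 0 ≤ B ∧ ∀ q : ℝ, 0 < q → (1 - η) * ρ ^ 2 * q ^ (ρ - 1) ≤ mom μ 1 q + B := by
  obtain ⟨B, hB, hle⟩ := h.le_lintegral hρ₁ hη hη₁
  refine ⟨B, hB, fun q hq => ?_⟩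
  have hi := h.integrable_mom hρ₁ 0 hq
  have h0 := h.mom_integrand_nonneg 1 q
  have hm := h.mom_nonneg 1 q
  have hl := hle q hq
  simp only [zero_add, pow_one, mom] at hi h0 hm ⊢
  rw [← ofReal_integral_eq_lintegral_ofReal hi h0, ← ENNReal.ofReal_add hm hB] at hl
  exact (ENNReal.ofReal_le_ofReal_iff (by positivity)).1 hl

lemma bernstein_le (hρ : 0 < ρ) (hρ₁ : ρ < 1) {q : ℝ} (hq : 0 < q) :
    bernstein μ q ≤ ρ * q ^ ρ :=
  integral_le_of_lintegral_le (by fun_prop) (h.bernstein_integrand_nonneg hq.le) (by positivity)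
    (h.lintegral_one_sub_exp_le hρ hρ₁ hq)

omit [SFinite μ] in
lemma bernstein_nonneg {q : ℝ} (hq : 0 ≤ q) : 0 ≤ bernstein μ q :=
  integral_nonneg_of_ae (h.bernstein_integrand_nonneg hq)

end HasTail

/-- Differentiation under the integral sign for integrands with derivative `φ(x) e^{-sx}`. -/
lemma hasDerivAt_integral_of_exp (hpos : ∀ᵐ x ∂μ, 0 < x) {F : ℝ → ℝ → ℝ} {φ : ℝ → ℝ}
    (hF : ∀ s, 0 < s → Integrable (F s) μ)
    (hφ : ∀ s, 0 < s → Integrable (fun x => φ x * Real.exp (-s * x)) μ)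
    (hd : ∀ x s, HasDerivAt (fun s => F s x) (φ x * Real.exp (-s * x)) s) {q : ℝ} (hq : 0 < q) :
    HasDerivAt (fun s => ∫ x, F s x ∂μ) (∫ x, φ x * Real.exp (-q * x) ∂μ) q := by
  refine (hasDerivAt_integral_of_dominated_loc_of_deriv_le (F := F)
    (F' := fun s x => φ x * Real.exp (-s * x)) (bound := fun x => ‖φ x * Real.exp (-(q / 2) * x)‖)
    (Ioi_mem_nhds (half_lt_self hq)) ?_ (hF q hq) (hφ q hq).aestronglyMeasurable ?_
    (hφ _ (half_pos hq)).norm (ae_of_all _ fun x s _ => hd x s)).2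
  · filter_upwards [Ioi_mem_nhds hq] with s hs using (hF s hs).aestronglyMeasurable
  · filter_upwards [hpos] with x hx s hs
    have hs' : q / 2 < s := hs
    rw [norm_mul, norm_mul, Real.norm_of_nonneg (Real.exp_pos _).le,
      Real.norm_of_nonneg (Real.exp_pos _).le]
    gcongr

lemma hasDerivAt_exp_neg_mul (x s : ℝ) :
    HasDerivAt (fun s : ℝ => Real.exp (-s * x)) (-x * Real.exp (-s * x)) s := by
  have := (((hasDerivAt_id s).neg).mul_const x).exp
  refine this.congr_deriv ?_
  simp only [id, Pi.neg_apply]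
  ring

namespace HasTail

variable (h : HasTail ρ μ) [SFinite μ]
include h

lemma hasDerivAt_bernstein (hρ : 0 < ρ) (hρ₁ : ρ < 1) {q : ℝ} (hq : 0 < q) :
    HasDerivAt (bernstein μ) (mom μ 1 q) q := by
  refine hasDerivAt_integral_of_exp h.pos (fun s hs => h.integrable_bernstein hρ hρ₁ hs)
    (fun s hs => h.integrable_mom hρ₁ 0 hs) (fun x s => ?_) hq
  refine ((hasDerivAt_exp_neg_mul x s).const_sub 1).congr_deriv ?_
  ring

lemma hasDerivAt_mom (hρ₁ : ρ < 1) (k : ℕ) {q : ℝ} (hq : 0 < q) :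
    HasDerivAt (mom μ (k + 1)) (-mom μ (k + 2) q) q := by
  have := hasDerivAt_integral_of_exp (φ := fun x => -x ^ (k + 2)) h.pos
    (fun s hs => h.integrable_mom hρ₁ k hs)
    (fun s hs => ((h.integrable_mom hρ₁ (k + 1) hs).neg).congr (ae_of_all _ fun x => by
      simp)) (fun x s => ?_) hq
  · refine this.congr_deriv ?_
    simp only [mom, neg_mul, integral_neg]
  · refine ((hasDerivAt_exp_neg_mul x s).const_mul (x ^ (k + 1))).congr_deriv ?_
    ring

end HasTail

/-! ### Comparison arguments for the Riccati-type equation. -/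

lemma antitoneOn_of_hasDerivAt_nonpos {g g' : ℝ → ℝ} {a : ℝ}
    (hd : ∀ q, a < q → HasDerivAt g (g' q) q) (h' : ∀ q, a < q → g' q ≤ 0) :
    AntitoneOn g (Ioi a) := by
  refine antitoneOn_of_deriv_nonpos (convex_Ioi a)
    (fun q hq => (hd q hq).continuousAt.continuousWithinAt) ?_ ?_
  · rw [interior_Ioi]
    exact fun q hq => (hd q hq).differentiableAt.differentiableWithinAt
  · rw [interior_Ioi]
    intro q hq
    rw [(hd q hq).deriv]
    exact h' q hq

lemma monotoneOn_of_hasDerivAt_nonneg {g g' : ℝ → ℝ} {a : ℝ}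
    (hd : ∀ q, a < q → HasDerivAt g (g' q) q) (h' : ∀ q, a < q → 0 ≤ g' q) :
    MonotoneOn g (Ioi a) := by
  have := (antitoneOn_of_hasDerivAt_nonpos (g := fun q => -g q) (g' := fun q => -g' q)
    (fun q hq => (hd q hq).neg) (fun q hq => by linarith [h' q hq])).neg
  simpa using this

/-- The common form of the comparisons from q = 0 below: the initial condition is a right limit,
since the functions are only differentiable on (0,∞). -/
lemma le_of_tendsto_of_hasDerivAt_nonneg {g g' : ℝ → ℝ} {L : ℝ}
    (hd : ∀ q, 0 < q → HasDerivAt g (g' q) q) (h' : ∀ q, 0 < q → 0 ≤ g' q)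
    (hL : Tendsto g (𝓝[>] 0) (𝓝 L)) {q : ℝ} (hq : 0 < q) : L ≤ g q := by
  refine le_of_tendsto hL ?_
  filter_upwards [Ioo_mem_nhdsGT hq] with s hs
  exact monotoneOn_of_hasDerivAt_nonneg hd h' hs.1 hq hs.2.le

lemma tendsto_const_mul_rpow_zero {a : ℝ} (ha : 0 < a) (c : ℝ) :
    Tendsto (fun q : ℝ => c * q ^ a) (𝓝[>] 0) (𝓝 0) := by
  have h := ((Real.continuousAt_rpow_const 0 a (Or.inr ha.le)).tendsto.const_mul c).mono_left
    (nhdsWithin_le_nhds (s := Ioi 0))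
  simpa [Real.zero_rpow ha.ne'] using h

/-- A non-negative solution `U`, with derivatives `U' = U₁` and `U'' = -U₂`, of the Laplace
transformed equation `q U₂ = (1-ρ) U₁ + 2 U₁ U + E`, behaving like `ρ q^ρ` at `0`. -/
structure IsRiccati (ρ : ℝ) (U U₁ U₂ E : ℝ → ℝ) : Prop where
  deriv : ∀ q, 0 < q → HasDerivAt U (U₁ q) q
  deriv_two : ∀ q, 0 < q → HasDerivAt U₁ (-U₂ q) q
  eqn : ∀ q, 0 < q → q * U₂ q = (1 - ρ) * U₁ q + 2 * U₁ q * U q + E q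
  nonneg : ∀ q, 0 < q → 0 ≤ U q
  le : ∀ q, 0 < q → U q ≤ ρ * q ^ ρ
  deriv_nonneg : ∀ q, 0 < q → 0 ≤ U₁ q
  deriv_le : ∀ q, 0 < q → U₁ q ≤ ρ ^ 2 * q ^ (ρ - 1)
  le_deriv : ∀ η : ℝ, 0 < η → η < 1 → ∃ B : ℝ, 0 ≤ B ∧
    ∀ q, 0 < q → (1 - η) * ρ ^ 2 * q ^ (ρ - 1) ≤ U₁ q + B
  defect_nonneg : ∀ q, 0 < q → 0 ≤ E q

namespace IsRiccati

variable {ρ : ℝ} {U U₁ U₂ E : ℝ → ℝ} (h : IsRiccati ρ U U₁ U₂ E)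
include h

lemma monotoneOn : MonotoneOn U (Ioi 0) :=
  monotoneOn_of_hasDerivAt_nonneg h.deriv h.deriv_nonneg

lemma tendsto_zero (hρ : 0 < ρ) : Tendsto U (𝓝[>] 0) (𝓝 0) := by
  refine squeeze_zero' ?_ ?_ (tendsto_const_mul_rpow_zero hρ ρ)
  · filter_upwards [self_mem_nhdsWithin] with q hq using h.nonneg q hq
  · filter_upwards [self_mem_nhdsWithin] with q hq using h.le q hq

lemma tendsto_mul_deriv_zero (hρ : 0 < ρ) : Tendsto (fun q => q * U₁ q) (𝓝[>] 0) (𝓝 0) := by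
  refine squeeze_zero' ?_ ?_ (tendsto_const_mul_rpow_zero hρ (ρ ^ 2))
  · filter_upwards [self_mem_nhdsWithin] with q hq
    exact mul_nonneg (le_of_lt hq) (h.deriv_nonneg q hq)
  · filter_upwards [self_mem_nhdsWithin] with q hq
    have hq' : 0 < q := hq
    calc q * U₁ q ≤ q * (ρ ^ 2 * q ^ (ρ - 1)) := by gcongr; exact h.deriv_le q hq
      _ = ρ ^ 2 * q ^ ρ := by rw [Real.rpow_sub_one hq'.ne']; field_simp

/-- Lower bound for `U q^(-ρ)` near `0`. -/
lemma le_of_pos (hρ : 0 < ρ) {η : ℝ} (hη : 0 < η) (hη₁ : η < 1) :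
    ∃ B : ℝ, 0 ≤ B ∧ ∀ q, 0 < q → (1 - η) * ρ * q ^ ρ ≤ U q + B * q := by
  obtain ⟨B, hB, hle⟩ := h.le_deriv η hη hη₁
  refine ⟨B, hB, fun q hq => ?_⟩
  have := le_of_tendsto_of_hasDerivAt_nonneg (L := 0)
    (g := fun q => U q + B * q - (1 - η) * ρ * q ^ ρ)
    (g' := fun q => U₁ q + B * 1 - (1 - η) * ρ * (ρ * q ^ (ρ - 1)))
    (fun s hs => ((h.deriv s hs).add ((hasDerivAt_id s).const_mul B)).sub
      ((Real.hasDerivAt_rpow_const (Or.inl hs.ne')).const_mul _))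
    (fun s hs => by linarith [hle s hs]) ?_ hq
  · linarith
  · have h1 := tendsto_const_mul_rpow_zero one_pos B
    simp only [Real.rpow_one] at h1
    simpa using ((h.tendsto_zero hρ).add h1).sub
      (tendsto_const_mul_rpow_zero hρ ((1 - η) * ρ))

lemma tendsto_div_rpow (hρ : 0 < ρ) (hρ₁ : ρ < 1) :
    Tendsto (fun q => U q * q ^ (-ρ)) (𝓝[>] 0) (𝓝 ρ) := by
  have hw : ∀ q : ℝ, 0 < q → q ^ ρ * q ^ (-ρ) = 1 := fun q hq => by
    rw [← Real.rpow_add hq]; simp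
  rw [tendsto_order]
  constructor
  · intro a ha
    obtain ⟨η, hη, hη₁, hηa⟩ : ∃ η : ℝ, 0 < η ∧ η < 1 ∧ a < (1 - η) * ρ := by
      rcases le_or_gt a 0 with ha0 | ha0
      · exact ⟨1 / 2, by norm_num, by norm_num, by linarith⟩
      -- This η makes (1-η)ρ the midpoint of a and ρ.
      · refine ⟨(ρ - a) / (2 * ρ), div_pos (by linarith) (by linarith),
          (div_lt_one (by linarith)).2 (by linarith), ?_⟩
        have : (1 - (ρ - a) / (2 * ρ)) * ρ = (ρ + a) / 2 := by field_simp; ring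
        linarith
    obtain ⟨B, hB, hle⟩ := h.le_of_pos hρ hη hη₁
    have hz := tendsto_const_mul_rpow_zero (show 0 < 1 - ρ by linarith) B
    filter_upwards [self_mem_nhdsWithin, hz.eventually (gt_mem_nhds (sub_pos.2 hηa))] with q hq hlt
    have hq' : 0 < q := hq
    have hp : 0 < q ^ (-ρ) := Real.rpow_pos_of_pos hq' _
    have h1 := mul_le_mul_of_nonneg_right (hle q hq) hp.le
    have h2 : B * q * q ^ (-ρ) = B * q ^ (1 - ρ) := by
      rw [mul_assoc, sub_eq_add_neg, Real.rpow_add hq', Real.rpow_one]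
    rw [mul_assoc, hw q hq', mul_one, add_mul, h2] at h1
    linarith
  · intro a ha
    filter_upwards [self_mem_nhdsWithin] with q hq
    have hq' : 0 < q := hq
    have hp : 0 < q ^ (-ρ) := Real.rpow_pos_of_pos hq' _
    have h1 := mul_le_mul_of_nonneg_right (h.le q hq) hp.le
    rw [mul_assoc, hw q hq', mul_one] at h1
    linarith

/-- U is nondecreasing, and positive near 0 because U q^(-ρ) → ρ > 0. Positivity permits passing to
the reciprocal of U q^(-ρ). -/
lemma pos (hρ : 0 < ρ) (hρ₁ : ρ < 1) {q : ℝ} (hq : 0 < q) : 0 < U q := by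
  obtain ⟨s, hs, hsq, hUs⟩ : ∃ s, 0 < s ∧ s < q ∧ 0 < U s * s ^ (-ρ) := by
    have := ((h.tendsto_div_rpow hρ hρ₁).eventually (lt_mem_nhds hρ)).and (Ioo_mem_nhdsGT hq)
    obtain ⟨s, hs1, hs2⟩ := this.exists
    exact ⟨s, hs2.1, hs2.2, hs1⟩
  have h1 : 0 < U s := pos_of_mul_pos_left hUs (Real.rpow_pos_of_pos hs _).le
  exact h1.trans_le (h.monotoneOn hs hq hsq.le)

/-- Since U'' = -U₂, the equation says exactly that the derivative of qU' - ρU + U² is -E; for the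
constant kernel this quantity is conserved. -/
lemma hasDerivAt_energy {q : ℝ} (hq : 0 < q) :
    HasDerivAt (fun q => q * U₁ q - ρ * U q + U q ^ 2) (-E q) q := by
  refine ((((hasDerivAt_id q).mul (h.deriv_two q hq)).sub ((h.deriv q hq).const_mul ρ)).add
    ((h.deriv q hq).pow 2)).congr_deriv ?_
  have := h.eqn q hq
  simp only [id]
  push_cast
  linear_combination -this

lemma tendsto_energy_zero (hρ : 0 < ρ) :
    Tendsto (fun q => q * U₁ q - ρ * U q + U q ^ 2) (𝓝[>] 0) (𝓝 0) := by
  have h0 := h.tendsto_zero hρ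
  simpa using ((h.tendsto_mul_deriv_zero hρ).sub (h0.const_mul ρ)).add (h0.pow 2)

lemma antitoneOn_energy : AntitoneOn (fun q => q * U₁ q - ρ * U q + U q ^ 2) (Ioi 0) :=
  antitoneOn_of_hasDerivAt_nonpos (fun _ hq => h.hasDerivAt_energy hq)
    (fun q hq => by linarith [h.defect_nonneg q hq])

lemma energy_nonpos (hρ : 0 < ρ) {q : ℝ} (hq : 0 < q) :
    q * U₁ q - ρ * U q + U q ^ 2 ≤ 0 := by
  have := le_of_tendsto_of_hasDerivAt_nonneg (fun _ hs => (h.hasDerivAt_energy hs).neg)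
    (fun q hq => by linarith [h.defect_nonneg q hq]) (h.tendsto_energy_zero hρ).neg hq
  simp only [Pi.neg_apply, neg_zero] at this
  linarith

/-- Nonpositive energy and qU' ≥ 0 leave U² ≤ ρU. -/
lemma le_const (hρ : 0 < ρ) (hρ₁ : ρ < 1) {q : ℝ} (hq : 0 < q) : U q ≤ ρ := by
  have h1 := h.energy_nonpos hρ hq
  have h2 := mul_nonneg hq.le (h.deriv_nonneg q hq)
  have h3 := h.pos hρ hρ₁ hq
  nlinarith

lemma hasDerivAt_div_rpow {q : ℝ} (hq : 0 < q) :
    HasDerivAt (fun q => U q * q ^ (-ρ)) (q ^ (-ρ) / q * (q * U₁ q - ρ * U q)) q := by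
  refine ((h.deriv q hq).mul (Real.hasDerivAt_rpow_const (Or.inl hq.ne'))).congr_deriv ?_
  rw [Real.rpow_sub_one hq.ne']
  field_simp
  ring

/-- Comparison with the explicit solution for the constant kernel. -/
lemma le_explicit (hρ : 0 < ρ) (hρ₁ : ρ < 1) {q : ℝ} (hq : 0 < q) :
    U q * q ^ (-ρ) ≤ ρ / (1 + q ^ ρ) := by
  have hw : ∀ s, 0 < s → 0 < U s * s ^ (-ρ) := fun s hs =>
    mul_pos (h.pos hρ hρ₁ hs) (Real.rpow_pos_of_pos hs _)
  -- The reciprocal of w = U q^(-ρ) linearises the Riccati equation: with H the energy, (1/w -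
  -- q^ρ/ρ)' = -q^(ρ-1) H / U² ≥ 0, with equality throughout for the explicit solution.
  have key := le_of_tendsto_of_hasDerivAt_nonneg (L := ρ⁻¹)
    (g := fun q => (U q * q ^ (-ρ))⁻¹ - ρ⁻¹ * q ^ ρ)
    (fun s hs => ((h.hasDerivAt_div_rpow hs).inv (hw s hs).ne').sub
      ((Real.hasDerivAt_rpow_const (Or.inl hs.ne')).const_mul _))
    (fun s hs => ?_) ?_ hq
  · have hp : 0 < q ^ ρ := Real.rpow_pos_of_pos hq _
    have h1 : (ρ / (1 + q ^ ρ))⁻¹ ≤ (U q * q ^ (-ρ))⁻¹ := by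
      have : (ρ / (1 + q ^ ρ))⁻¹ = ρ⁻¹ + ρ⁻¹ * q ^ ρ := by field_simp
      linarith
    exact (inv_le_inv₀ (by positivity) (hw q hq)).1 h1
  · have hp : 0 < s ^ ρ := Real.rpow_pos_of_pos hs _
    have hU := h.pos hρ hρ₁ hs
    have he := h.energy_nonpos hρ hs
    have h1 : -(s ^ (-ρ) / s * (s * U₁ s - ρ * U s)) / (U s * s ^ (-ρ)) ^ 2 -
        ρ⁻¹ * (ρ * s ^ (ρ - 1)) =
        s ^ ρ / s * (-(s * U₁ s - ρ * U s + U s ^ 2)) / U s ^ 2 := by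
      rw [Real.rpow_neg hs.le, Real.rpow_sub_one hs.ne']
      field_simp
      ring
    rw [h1]
    have : 0 ≤ -(s * U₁ s - ρ * U s + U s ^ 2) := by linarith
    positivity
  · simpa using ((h.tendsto_div_rpow hρ hρ₁).inv₀ hρ.ne').sub (tendsto_const_mul_rpow_zero hρ ρ⁻¹)

/-- The defect bound integrated from 0, where the energy vanishes. -/
lemma neg_le_energy (hρ : 0 < ρ) {κ c : ℝ} (hκ : 0 < κ)
    (hE : ∀ q, 0 < q → E q ≤ c * q ^ (ρ + κ - 1)) {q : ℝ} (hq : 0 < q) :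
    -(c / (ρ + κ) * q ^ (ρ + κ)) ≤ q * U₁ q - ρ * U q + U q ^ 2 := by
  have hs : 0 < ρ + κ := by linarith
  have := le_of_tendsto_of_hasDerivAt_nonneg (L := 0)
    (fun s hs => (h.hasDerivAt_energy hs).add ((Real.hasDerivAt_rpow_const (p := ρ + κ)
      (Or.inl hs.ne')).const_mul (c / (ρ + κ)))) (fun s hs' => ?_) ?_ hq
  · simp only [Pi.add_apply] at this
    linarith
  · have := hE s hs'
    have h2 : c / (ρ + κ) * ((ρ + κ) * s ^ (ρ + κ - 1)) = c * s ^ (ρ + κ - 1) := by field_simp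
    linarith
  · have := (h.tendsto_energy_zero hρ).add (tendsto_const_mul_rpow_zero hs (c / (ρ + κ)))
    rwa [add_zero] at this

/-- With w = U q^(-ρ) and v = ρ/(1+q^ρ), one has (w - v)' = q^(-ρ-1) H + q^(ρ-1)(v² - w²). The upper
bound `le_explicit` makes the last term nonnegative, so no Grönwall argument is needed: only the
lower bound on H is integrated, which costs c/((ρ+κ)κ) q^κ. -/
lemma explicit_le (hρ : 0 < ρ) (hρ₁ : ρ < 1) {κ c : ℝ} (hκ : 0 < κ)
    (hE : ∀ q, 0 < q → E q ≤ c * q ^ (ρ + κ - 1)) {q : ℝ} (hq : 0 < q) :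
    ρ / (1 + q ^ ρ) ≤ U q * q ^ (-ρ) + c / (ρ + κ) / κ * q ^ κ := by
  have hden : ∀ s : ℝ, 0 < s → 1 + s ^ ρ ≠ 0 := fun s hs => by
    have : 0 < s ^ ρ := Real.rpow_pos_of_pos hs _
    positivity
  have key := le_of_tendsto_of_hasDerivAt_nonneg (L := 0)
    (g := fun q => U q * q ^ (-ρ) + c / (ρ + κ) / κ * q ^ κ - ρ * (1 + q ^ ρ)⁻¹)
    (fun s hs => ((h.hasDerivAt_div_rpow hs).add
      ((Real.hasDerivAt_rpow_const (Or.inl hs.ne')).const_mul _)).sub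
      ((((Real.hasDerivAt_rpow_const (Or.inl hs.ne')).const_add 1).inv (hden s hs)).const_mul ρ))
    (fun s hs => ?_) ?_ hq
  · rw [div_eq_mul_inv]
    linarith
  · have hp : 0 < s ^ ρ := Real.rpow_pos_of_pos hs _
    have he := h.neg_le_energy hρ hκ hE hs
    have hle := h.le_explicit hρ hρ₁ hs
    have hU := h.nonneg s hs
    have hsq : (U s * s ^ (-ρ)) ^ 2 ≤ (ρ / (1 + s ^ ρ)) ^ 2 := by
      have : 0 ≤ U s * s ^ (-ρ) := mul_nonneg hU (Real.rpow_nonneg hs.le _)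
      gcongr
    have hsk : 0 < ρ + κ := by linarith
    have h1 : s ^ (-ρ) / s * (s * U₁ s - ρ * U s) +
        c / (ρ + κ) / κ * (κ * s ^ (κ - 1)) - ρ * (-(ρ * s ^ (ρ - 1)) / (1 + s ^ ρ) ^ 2) =
        s ^ (-ρ) / s * ((s * U₁ s - ρ * U s + U s ^ 2) +
          c / (ρ + κ) * s ^ (ρ + κ)) +
        s ^ ρ / s * ((ρ / (1 + s ^ ρ)) ^ 2 - (U s * s ^ (-ρ)) ^ 2) := by
      have hd := hden s hs
      rw [Real.rpow_neg hs.le, Real.rpow_sub_one hs.ne', Real.rpow_sub_one hs.ne',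
        Real.rpow_add hs]
      field_simp
      ring
    rw [h1]
    have h2 : 0 ≤ (s * U₁ s - ρ * U s + U s ^ 2) + c / (ρ + κ) * s ^ (ρ + κ) := by
      linarith
    have h3 : 0 ≤ (ρ / (1 + s ^ ρ)) ^ 2 - (U s * s ^ (-ρ)) ^ 2 := by linarith
    have h4 : 0 < s ^ (-ρ) := Real.rpow_pos_of_pos hs _
    positivity
  · have h1 := tendsto_const_mul_rpow_zero hρ 1
    simp only [one_mul] at h1
    have h2 : Tendsto (fun q : ℝ => ρ * (1 + q ^ ρ)⁻¹) (𝓝[>] 0) (𝓝 ρ) := by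
      simpa using ((h1.const_add 1).inv₀ (by norm_num)).const_mul ρ
    simpa using ((h.tendsto_div_rpow hρ hρ₁).add
      (tendsto_const_mul_rpow_zero hκ (c / (ρ + κ) / κ))).sub h2

/-- Decay of `A - U` for the limit `A` of `U` at infinity, once `U` is large somewhere. -/
lemma sub_le (hρ : 0 < ρ) (hρ₁ : ρ < 1) {A θ q₀ : ℝ} (hA : Tendsto U atTop (𝓝 A))
    (hA₁ : Tendsto (fun q => q * U₁ q) atTop (𝓝 0)) (hq₀ : 0 < q₀) (hθ : (ρ + θ) / 2 ≤ U q₀)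
    (hθ₀ : 0 < θ) {q : ℝ} (hq : 0 < q) :
    A - U q ≤ ρ * (1 + q₀) ^ θ * (1 + q) ^ (-θ) := by
  have hUA : ∀ s, 0 < s → U s ≤ A := fun s hs => by
    refine ge_of_tendsto hA ?_
    filter_upwards [Ici_mem_atTop s] with t ht
    exact h.monotoneOn hs (hs.trans_le ht) ht
  have hAρ : A ≤ ρ := le_of_tendsto hA (by
    filter_upwards [Ioi_mem_atTop 0] with t ht using h.le_const hρ hρ₁ ht)
  have hFρ : ∀ s, 0 < s → A - U s ≤ ρ := fun s hs => by linarith [h.nonneg s hs]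
  have hen : ∀ s, 0 < s → -ρ * A + A ^ 2 ≤ s * U₁ s - ρ * U s + U s ^ 2 := fun s hs => by
    have hlim : Tendsto (fun q => q * U₁ q - ρ * U q + U q ^ 2) atTop (𝓝 (0 - ρ * A + A ^ 2)) :=
      (hA₁.sub (hA.const_mul ρ)).add (hA.pow 2)
    have : 0 - ρ * A + A ^ 2 ≤ s * U₁ s - ρ * U s + U s ^ 2 := by
      refine le_of_tendsto hlim ?_
      filter_upwards [Ici_mem_atTop s] with t ht
      exact h.antitoneOn_energy hs (hs.trans_le ht) ht
    linarith
  have hanti : AntitoneOn (fun s => (A - U s) * s ^ θ) (Ici q₀) := by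
    have hd : ∀ s, 0 < s → HasDerivAt (fun s => (A - U s) * s ^ θ)
        (s ^ θ / s * (θ * (A - U s) - s * U₁ s)) s := fun s hs => by
      refine (((h.deriv s hs).const_sub A).mul
        (Real.hasDerivAt_rpow_const (Or.inl hs.ne'))).congr_deriv ?_
      rw [Real.rpow_sub_one hs.ne']
      field_simp
      ring
    refine antitoneOn_of_deriv_nonpos (convex_Ici q₀)
      (fun s hs => (hd s (hq₀.trans_le hs)).continuousAt.continuousWithinAt) ?_ ?_
    · exact fun s hs =>
        (hd s (hq₀.trans_le (interior_subset hs))).differentiableAt.differentiableWithinAt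
    · intro s hs
      have hs₀ : q₀ ≤ s := interior_subset hs
      have hs' : 0 < s := hq₀.trans_le hs₀
      rw [(hd s hs').deriv]
      have h1 := h.monotoneOn hq₀ hs' hs₀
      have h2 := hUA s hs'
      have h3 := hen s hs'
      -- Monotonicity of the energy up to its limit gives sU' ≥ (A-U)(A+U-ρ), and A ≥ U ≥ (ρ+θ)/2
      -- beyond q₀ makes the second factor at least θ.
      have h4 : θ * (A - U s) - s * U₁ s ≤ 0 := by
        nlinarith [mul_nonneg (sub_nonneg.2 h2) (show 0 ≤ A + U s - ρ - θ by linarith)]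
      have h5 : 0 < s ^ θ := Real.rpow_pos_of_pos hs' _
      exact mul_nonpos_of_nonneg_of_nonpos (by positivity) h4
  rcases le_total q q₀ with hle | hle
  · refine (hFρ q hq).trans ?_
    have h1 : 1 ≤ (1 + q₀) ^ θ * (1 + q) ^ (-θ) := by
      rw [Real.rpow_neg (by linarith), ← div_eq_mul_inv,
        one_le_div (Real.rpow_pos_of_pos (by linarith) _)]
      exact Real.rpow_le_rpow (by linarith) (by linarith) hθ₀.le
    nlinarith
  · have h1 : (A - U q) * q ^ θ ≤ (A - U q₀) * q₀ ^ θ := hanti (mem_Ici.2 le_rfl) hle hle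
    have h2 : (A - U q₀) * q₀ ^ θ ≤ ρ * q₀ ^ θ := by
      gcongr
      exact hFρ q₀ hq₀
    have hqθ : 0 < q ^ θ := Real.rpow_pos_of_pos hq _
    have h3 : A - U q ≤ ρ * (q₀ / q) ^ θ := by
      rw [Real.div_rpow hq₀.le hq.le, ← mul_div_assoc, le_div_iff₀ hqθ]
      linarith
    have h4 : (q₀ / q) ^ θ ≤ ((1 + q₀) / (1 + q)) ^ θ := by
      refine Real.rpow_le_rpow (by positivity) ?_ hθ₀.le
      rw [div_le_div_iff₀ hq (by linarith)]
      nlinarith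
    rw [Real.div_rpow (x := 1 + q₀) (by linarith) (by linarith)] at h4
    rw [Real.rpow_neg (by linarith), mul_assoc, ← div_eq_mul_inv]
    exact h3.trans (by gcongr)

end IsRiccati

/-! ### Estimate of the perturbation term. -/

lemma rpow_le_exp {α t : ℝ} (hα₀ : 0 ≤ α) (hα₁ : α ≤ 1) (ht : 0 ≤ t) : t ^ α ≤ Real.exp t := by
  have h1 : t ^ α ≤ (1 + t) ^ α := Real.rpow_le_rpow ht (by linarith) hα₀
  have h2 : (1 + t) ^ α ≤ (1 + t) ^ (1 : ℝ) := Real.rpow_le_rpow_of_exponent_le (by linarith) hα₁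
  rw [Real.rpow_one] at h2
  linarith [Real.add_one_le_exp t]

lemma rpow_mul_exp_le {α s x : ℝ} (hα₀ : 0 ≤ α) (hα₁ : α ≤ 1) (hs : 0 < s) (hx : 0 < x) :
    x ^ α * Real.exp (-s * x) ≤ s ^ (-α) := by
  have h := rpow_le_exp hα₀ hα₁ (mul_pos hs hx).le
  rw [Real.mul_rpow hs.le hx.le] at h
  have hsα : 0 < s ^ α := Real.rpow_pos_of_pos hs _
  rw [neg_mul, Real.exp_neg, Real.rpow_neg hs.le, ← div_eq_mul_inv,
    div_le_iff₀ (Real.exp_pos _), inv_mul_eq_div, le_div_iff₀ hsα]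
  linarith

/-- Splitting at a = λ; the free parameter λ is later chosen to balance the mass bound against the
bound on the Bernstein function. -/
lemma rpow_one_sub_le {α a lam : ℝ} (hα₀ : 0 ≤ α) (hα₁ : α < 1) (ha : 0 ≤ a) (hlam : 0 < lam) :
    a ^ (1 - α) ≤ lam ^ (-α) * a + lam ^ (1 - α) := by
  have h1 : 0 < lam ^ (-α) := Real.rpow_pos_of_pos hlam _
  have h2 : 0 < lam ^ (1 - α) := Real.rpow_pos_of_pos hlam _
  rcases le_total a lam with h | h
  · have := Real.rpow_le_rpow ha h (show 0 ≤ 1 - α by linarith)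
    nlinarith
  · have ha' : 0 < a := hlam.trans_le h
    have h3 : a ^ (1 - α) = a ^ (-α) * a := by
      rw [sub_eq_neg_add, Real.rpow_add ha', Real.rpow_one]
    have h4 : a ^ (-α) ≤ lam ^ (-α) := Real.rpow_le_rpow_of_nonpos hlam h (by linarith)
    rw [h3]
    nlinarith

/-- The singularity z^(-α) is paid for by the α-th power of 1 - e^{-pz} ≤ pz, leaving a factor that
is still integrable against a finite measure. -/
lemma rpow_neg_mul_one_sub_exp_le {α p z : ℝ} (hα₀ : 0 ≤ α) (hp : 0 < p) (hz : 0 < z) :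
    z ^ (-α) * (1 - Real.exp (-p * z)) ≤ p ^ α * (1 - Real.exp (-p * z)) ^ (1 - α) := by
  have hpos : 0 < 1 - Real.exp (-p * z) := by
    have := Real.exp_lt_one_iff.2 (show -p * z < 0 by nlinarith)
    linarith
  have hle : 1 - Real.exp (-p * z) ≤ p * z := by linarith [Real.add_one_le_exp (-p * z)]
  have h1 := Real.rpow_le_rpow hpos.le hle hα₀
  rw [Real.mul_rpow hp.le hz.le] at h1
  have hzα : 0 < z ^ α := Real.rpow_pos_of_pos hz _
  have h2 : 1 - Real.exp (-p * z) =
      (1 - Real.exp (-p * z)) ^ α * (1 - Real.exp (-p * z)) ^ (1 - α) := by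
    rw [← Real.rpow_add hpos]; simp
  have h3 : 0 < (1 - Real.exp (-p * z)) ^ (1 - α) := Real.rpow_pos_of_pos hpos _
  rw [Real.rpow_neg hz.le, inv_mul_eq_div, div_le_iff₀ hzα]
  calc _ = (1 - Real.exp (-p * z)) ^ α * (1 - Real.exp (-p * z)) ^ (1 - α) := h2
    _ ≤ p ^ α * z ^ α * (1 - Real.exp (-p * z)) ^ (1 - α) := by gcongr
    _ = _ := by ring

lemma rpow_one_sub_mul_exp_le {α p y : ℝ} (hα₀ : 0 ≤ α) (hα₁ : α < 1) (hp : 0 < p) (hy : 0 < y) :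
    y ^ (1 - α) * Real.exp (-p * y) ≤ p ^ (α - 1) * (1 - Real.exp (-p * y)) ^ (1 - α) := by
  have h1 : p * y * Real.exp (-p * y) ≤ 1 - Real.exp (-p * y) := by
    have h := Real.add_one_le_exp (p * y)
    have h2 : Real.exp (p * y) * Real.exp (-p * y) = 1 := by rw [← Real.exp_add]; simp
    nlinarith [Real.exp_pos (-p * y)]
  have h2 := Real.rpow_le_rpow (by positivity) h1 (show 0 ≤ 1 - α by linarith)
  rw [Real.mul_rpow (by positivity) (Real.exp_pos _).le, Real.mul_rpow hp.le hy.le,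
    ← Real.exp_mul] at h2
  have h3 : Real.exp (-p * y) ≤ Real.exp (-p * y * (1 - α)) := by
    apply Real.exp_le_exp.2
    have : 0 ≤ p * y * α := by positivity
    linarith
  have h4 : p ^ (α - 1) * p ^ (1 - α) = 1 := by rw [← Real.rpow_add hp]; simp
  have h5 : 0 < p ^ (α - 1) := Real.rpow_pos_of_pos hp _
  calc y ^ (1 - α) * Real.exp (-p * y)
      = p ^ (α - 1) * (p ^ (1 - α) * y ^ (1 - α) * Real.exp (-p * y)) := by
        linear_combination -(y ^ (1 - α) * Real.exp (-p * y)) * h4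
    _ ≤ p ^ (α - 1) * (p ^ (1 - α) * y ^ (1 - α) * Real.exp (-p * y * (1 - α))) := by gcongr
    _ ≤ _ := by gcongr

variable {μ : Measure ℝ} {ρ : ℝ}

/-- The part of the coagulation term, in Laplace variables, due to the perturbation `V`. -/
noncomputable def defect (V : ℝ → ℝ → ℝ) (μ : Measure ℝ) (q : ℝ) : ℝ≥0∞ :=
  ∫⁻ y, ∫⁻ z, ENNReal.ofReal (y * V y z) *
    ENNReal.ofReal (Real.exp (-q * y) * (1 - Real.exp (-q * z))) ∂μ ∂μ

namespace HasTail

variable (h : HasTail ρ μ) [SFinite μ]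
include h

/-- Half of the exponential absorbs y^α, the other half is left for the first-moment bound at p/2.
-/
lemma lintegral_rpow_mul_le (hρ₁ : ρ < 1) {α : ℝ} (hα₀ : 0 ≤ α) (hα₁ : α ≤ 1) {p : ℝ}
    (hp : 0 < p) : ∫⁻ y, ENNReal.ofReal (y ^ α * (y * Real.exp (-p * y))) ∂μ ≤
      ENNReal.ofReal (ρ ^ 2 * 2 ^ (1 + α - ρ) * p ^ (ρ - α - 1)) := by
  have hp2 := half_pos hp
  calc _ ≤ ∫⁻ y, ENNReal.ofReal ((p / 2) ^ (-α)) *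
        ENNReal.ofReal (y * Real.exp (-(p / 2) * y)) ∂μ := by
        refine lintegral_mono_ae ?_
        filter_upwards [h.pos] with y hy
        have hy' : 0 < y := hy
        rw [← ENNReal.ofReal_mul (by positivity)]
        refine ENNReal.ofReal_le_ofReal ?_
        calc y ^ α * (y * Real.exp (-p * y)) =
            (y ^ α * Real.exp (-(p / 2) * y)) * (y * Real.exp (-(p / 2) * y)) := by
              rw [show -p * y = -(p / 2) * y + -(p / 2) * y by ring, Real.exp_add]; ring
          _ ≤ _ := by gcongr; exact rpow_mul_exp_le hα₀ hα₁ hp2 hy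
    _ ≤ ENNReal.ofReal ((p / 2) ^ (-α)) * ENNReal.ofReal (ρ ^ 2 * (p / 2) ^ (ρ - 1)) := by
        rw [lintegral_const_mul' _ _ ENNReal.ofReal_ne_top]
        gcongr
        exact h.lintegral_le hρ₁ hp2
    _ = _ := by
        rw [← ENNReal.ofReal_mul (by positivity)]
        congr 1
        have h1 : (p / 2) ^ (-α) * (p / 2) ^ (ρ - 1) = (p / 2) ^ (ρ - α - 1) := by
          rw [← Real.rpow_add hp2]; congr 1; ring
        have h2 : (p / 2) ^ (ρ - α - 1) = 2 ^ (1 + α - ρ) * p ^ (ρ - α - 1) := by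
          rw [Real.div_rpow hp.le (by norm_num), show 1 + α - ρ = -(ρ - α - 1) by ring,
            Real.rpow_neg (by norm_num)]
          field_simp
        linear_combination ρ ^ 2 * h1 + ρ ^ 2 * h2

lemma lintegral_rpow_mul_one_sub_exp_le (hρ₁ : ρ < 1) {α : ℝ} (hα₀ : 0 ≤ α) (hα₁ : α ≤ 1)
    (hαρ : α < ρ) {p : ℝ} (hp : 0 < p) :
    ∫⁻ z, ENNReal.ofReal (z ^ α * (1 - Real.exp (-p * z))) ∂μ ≤
      ENNReal.ofReal (ρ ^ 2 * 2 ^ (1 + α - ρ) / (ρ - α) * p ^ (ρ - α)) := by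
  rw [lintegral_one_sub_exp_eq h.pos p hp (by fun_prop) (fun x hx => Real.rpow_nonneg hx.le α),
    ← lintegral_rpow_Ioo (by linarith) (by positivity) hp]
  exact setLIntegral_mono' measurableSet_Ioo fun s hs =>
    h.lintegral_rpow_mul_le hρ₁ hα₀ hα₁ hs.1

/-- Interpolation with λ = p^ρ between total mass at most ρ and Bernstein function at most ρp^ρ. The
resulting exponent ρ(1-α) is the gain κ in the defect estimate. -/
lemma lintegral_one_sub_exp_rpow_le (hρ : 0 < ρ) (hρ₁ : ρ < 1) (hA : μ univ ≤ ENNReal.ofReal ρ)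
    {α : ℝ} (hα₀ : 0 ≤ α) (hα₁ : α < 1) {p : ℝ} (hp : 0 < p) :
    ∫⁻ z, ENNReal.ofReal ((1 - Real.exp (-p * z)) ^ (1 - α)) ∂μ ≤
      ENNReal.ofReal (2 * ρ * p ^ (ρ * (1 - α))) := by
  have hlam : 0 < p ^ ρ := Real.rpow_pos_of_pos hp _
  calc _ ≤ ∫⁻ z, (ENNReal.ofReal ((p ^ ρ) ^ (-α)) * ENNReal.ofReal (1 - Real.exp (-p * z)) +
        ENNReal.ofReal ((p ^ ρ) ^ (1 - α))) ∂μ := by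
        refine lintegral_mono_ae ?_
        filter_upwards [h.pos] with z hz
        have hn := one_sub_exp_nonneg hp.le hz.le
        rw [← ENNReal.ofReal_mul (by positivity), ← ENNReal.ofReal_add (by positivity)
          (by positivity)]
        exact ENNReal.ofReal_le_ofReal (rpow_one_sub_le hα₀ hα₁ hn hlam)
    _ ≤ ENNReal.ofReal ((p ^ ρ) ^ (-α)) * ENNReal.ofReal (ρ * p ^ ρ) +
        ENNReal.ofReal ((p ^ ρ) ^ (1 - α)) * ENNReal.ofReal ρ := by
        rw [lintegral_add_right _ measurable_const, lintegral_const,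
          lintegral_const_mul' _ _ ENNReal.ofReal_ne_top]
        gcongr
        exact h.lintegral_one_sub_exp_le hρ hρ₁ hp
    _ = _ := by
        rw [← ENNReal.ofReal_mul (by positivity), ← ENNReal.ofReal_mul (by positivity),
          ← ENNReal.ofReal_add (by positivity) (by positivity)]
        congr 1
        rw [Real.rpow_mul hp.le, sub_eq_neg_add, Real.rpow_add hlam, Real.rpow_one]
        ring

/-- Smallness of the perturbation, uniformly in the profile. -/
lemma defect_le (hρ : 0 < ρ) (hρ₁ : ρ < 1) (hA : μ univ ≤ ENNReal.ofReal ρ)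
    {α : ℝ} (hα₀ : 0 ≤ α) (hαρ : α < ρ) {V : ℝ → ℝ → ℝ}
    (hV : ∀ y z, 0 < y → 0 < z → V y z ≤ (y / z) ^ α + (z / y) ^ α) {p : ℝ} (hp : 0 < p) :
    defect V μ p ≤ ENNReal.ofReal (2 * ρ * (ρ ^ 2 * 2 ^ (1 + α - ρ)) * (1 + (ρ - α)⁻¹) *
      p ^ (ρ + ρ * (1 - α) - 1)) := by
  have hα₁ : α < 1 := hαρ.trans hρ₁
  have hαρ' : 0 < ρ - α := by linarith
  -- The kernel bound is dominated by two products: `a` in y times `b` in z for (y/z)^α, and `b` in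
  -- y times `d` in z for (z/y)^α. In both, the powers of p add up to ρ + ρ(1-α) - 1.
  let a : ℝ → ℝ := fun y => y ^ α * (y * Real.exp (-p * y))
  let b : ℝ → ℝ := fun z => (1 - Real.exp (-p * z)) ^ (1 - α)
  let d : ℝ → ℝ := fun z => z ^ α * (1 - Real.exp (-p * z))
  have hmul : ∀ u v : ℝ → ℝ, Measurable u → Measurable v →
      ∫⁻ y, ∫⁻ z, ENNReal.ofReal (u y) * ENNReal.ofReal (v z) ∂μ ∂μ =
        (∫⁻ y, ENNReal.ofReal (u y) ∂μ) * ∫⁻ z, ENNReal.ofReal (v z) ∂μ := by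
    intro u v hu hv
    simp_rw [lintegral_const_mul' _ _ ENNReal.ofReal_ne_top]
    exact lintegral_mul_const _ (by fun_prop)
  have ha : Measurable a := by fun_prop
  have hb : Measurable b := by fun_prop
  have hd : Measurable d := by fun_prop
  have hpt : ∀ y z, 0 < y → 0 < z → ENNReal.ofReal (y * V y z) *
      ENNReal.ofReal (Real.exp (-p * y) * (1 - Real.exp (-p * z))) ≤
      ENNReal.ofReal (p ^ α) * (ENNReal.ofReal (a y) * ENNReal.ofReal (b z)) +
      ENNReal.ofReal (p ^ (α - 1)) * (ENNReal.ofReal (b y) * ENNReal.ofReal (d z)) := by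
    intro y z hy hz
    have hnz := one_sub_exp_nonneg hp.le hz.le
    have hny := one_sub_exp_nonneg hp.le hy.le
    have hay : 0 ≤ a y := by positivity
    have hbz : 0 ≤ b z := by positivity
    have hby : 0 ≤ b y := by positivity
    have hdz : 0 ≤ d z := by positivity
    have hpα : 0 ≤ p ^ α := by positivity
    have hpα' : 0 ≤ p ^ (α - 1) := by positivity
    rw [← ENNReal.ofReal_mul hay, ← ENNReal.ofReal_mul hpα,
      ← ENNReal.ofReal_mul hby, ← ENNReal.ofReal_mul hpα',
      ← ENNReal.ofReal_add (by positivity) (by positivity),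
      ← ENNReal.ofReal_mul' (by positivity)]
    refine ENNReal.ofReal_le_ofReal ?_
    calc y * V y z * (Real.exp (-p * y) * (1 - Real.exp (-p * z)))
        ≤ y * ((y / z) ^ α + (z / y) ^ α) *
          (Real.exp (-p * y) * (1 - Real.exp (-p * z))) := by
          gcongr
          exact hV y z hy hz
      _ = a y * (z ^ (-α) * (1 - Real.exp (-p * z))) +
          (y ^ (1 - α) * Real.exp (-p * y)) * d z := by
          simp only [a, d]
          rw [Real.div_rpow hy.le hz.le, Real.div_rpow hz.le hy.le, Real.rpow_neg hz.le,
            Real.rpow_sub hy, Real.rpow_one]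
          field_simp
      _ ≤ a y * (p ^ α * b z) + (p ^ (α - 1) * b y) * d z := by
          exact add_le_add
            (mul_le_mul_of_nonneg_left (rpow_neg_mul_one_sub_exp_le hα₀ hp hz) hay)
            (mul_le_mul_of_nonneg_right (rpow_one_sub_mul_exp_le hα₀ hα₁ hp hy) hdz)
      _ = _ := by ring
  calc defect V μ p ≤ ∫⁻ y, ∫⁻ z,
        (ENNReal.ofReal (p ^ α) * (ENNReal.ofReal (a y) * ENNReal.ofReal (b z)) +
        ENNReal.ofReal (p ^ (α - 1)) * (ENNReal.ofReal (b y) * ENNReal.ofReal (d z))) ∂μ ∂μ := by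
        refine lintegral_mono_ae ?_
        filter_upwards [h.pos] with y hy
        refine lintegral_mono_ae ?_
        filter_upwards [h.pos] with z hz
        exact hpt y z hy hz
    _ = ENNReal.ofReal (p ^ α) * ((∫⁻ y, ENNReal.ofReal (a y) ∂μ) *
          ∫⁻ z, ENNReal.ofReal (b z) ∂μ) + ENNReal.ofReal (p ^ (α - 1)) *
          ((∫⁻ y, ENNReal.ofReal (b y) ∂μ) * ∫⁻ z, ENNReal.ofReal (d z) ∂μ) := by
        rw [← hmul a b ha hb, ← hmul b d hb hd, ← lintegral_const_mul' _ _ ENNReal.ofReal_ne_top,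
          ← lintegral_const_mul' _ _ ENNReal.ofReal_ne_top,
          ← lintegral_add_left (Measurable.const_mul (Measurable.lintegral_prod_right'
            (f := fun q : ℝ × ℝ => ENNReal.ofReal (a q.1) * ENNReal.ofReal (b q.2))
            (by fun_prop)) _)]
        refine lintegral_congr fun y => ?_
        rw [← lintegral_const_mul' _ _ ENNReal.ofReal_ne_top,
          ← lintegral_const_mul' _ _ ENNReal.ofReal_ne_top, ← lintegral_add_left (by fun_prop)]
    _ ≤ ENNReal.ofReal (p ^ α) * (ENNReal.ofReal (ρ ^ 2 * 2 ^ (1 + α - ρ) * p ^ (ρ - α - 1)) *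
          ENNReal.ofReal (2 * ρ * p ^ (ρ * (1 - α)))) + ENNReal.ofReal (p ^ (α - 1)) *
          (ENNReal.ofReal (2 * ρ * p ^ (ρ * (1 - α))) *
            ENNReal.ofReal (ρ ^ 2 * 2 ^ (1 + α - ρ) / (ρ - α) * p ^ (ρ - α))) := by
        gcongr
        · exact h.lintegral_rpow_mul_le hρ₁ hα₀ hα₁.le hp
        · exact h.lintegral_one_sub_exp_rpow_le hρ hρ₁ hA hα₀ hα₁ hp
        · exact h.lintegral_one_sub_exp_rpow_le hρ hρ₁ hA hα₀ hα₁ hp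
        · exact h.lintegral_rpow_mul_one_sub_exp_le hρ₁ hα₀ hα₁.le hαρ hp
    _ = _ := by
        rw [← ENNReal.ofReal_mul (by positivity), ← ENNReal.ofReal_mul (by positivity),
          ← ENNReal.ofReal_mul (by positivity), ← ENNReal.ofReal_mul (by positivity),
          ← ENNReal.ofReal_add (by positivity) (by positivity)]
        congr 1
        have h1 : p ^ α * p ^ (ρ - α - 1) * p ^ (ρ * (1 - α)) = p ^ (ρ + ρ * (1 - α) - 1) := by
          rw [← Real.rpow_add hp, ← Real.rpow_add hp]; congr 1; ring
        have h2 : p ^ (α - 1) * p ^ (ρ * (1 - α)) * p ^ (ρ - α) =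
            p ^ (ρ + ρ * (1 - α) - 1) := by
          rw [← Real.rpow_add hp, ← Real.rpow_add hp]; congr 1; ring
        linear_combination (2 * ρ * (ρ ^ 2 * 2 ^ (1 + α - ρ))) * h1 +
          (2 * ρ * (ρ ^ 2 * 2 ^ (1 + α - ρ)) * (ρ - α)⁻¹) * h2

end HasTail

/-! ### From a profile to its measure and to the Laplace-transformed equation. -/

/-- The measure on `(0,∞)` with density `f`. -/
noncomputable def profileMeasure (f : ℝ → ℝ) : Measure ℝ :=
  (volume.restrict (Ioi 0)).withDensity fun x => ENNReal.ofReal (f x)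

instance (f : ℝ → ℝ) : SFinite (profileMeasure f) := by
  unfold profileMeasure
  infer_instance

lemma profileMeasure_pos (f : ℝ → ℝ) : ∀ᵐ x ∂profileMeasure f, 0 < x :=
  (withDensity_absolutelyContinuous _ _).ae_le (ae_restrict_mem measurableSet_Ioi)

section Density

variable {f : ℝ → ℝ} (hm : AEStronglyMeasurable f (volume.restrict (Ioi 0)))
include hm

lemma setLIntegral_profileMeasure {s : Set ℝ} (hs : MeasurableSet s) (hsub : s ⊆ Ioi 0)
    (g : ℝ → ℝ≥0∞) :
    ∫⁻ x in s, g x ∂profileMeasure f = ∫⁻ x in s, ENNReal.ofReal (f x) * g x := by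
  rw [profileMeasure, restrict_withDensity hs, Measure.restrict_restrict hs,
    inter_eq_left.2 hsub, lintegral_withDensity_eq_lintegral_mul_non_measurable₀]
  · rfl
  · exact ((hm.mono_measure (Measure.restrict_mono hsub le_rfl)).aemeasurable).ennreal_ofReal
  · exact ae_of_all _ fun x => ENNReal.ofReal_lt_top

lemma lintegral_profileMeasure (g : ℝ → ℝ≥0∞) :
    ∫⁻ x, g x ∂profileMeasure f = ∫⁻ x in Ioi 0, ENNReal.ofReal (f x) * g x := by
  rw [profileMeasure, lintegral_withDensity_eq_lintegral_mul_non_measurable₀]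
  · rfl
  · exact hm.aemeasurable.ennreal_ofReal
  · exact ae_of_all _ fun x => ENNReal.ofReal_lt_top

lemma integral_profileMeasure (hn : ∀ᵐ x ∂(volume.restrict (Ioi (0 : ℝ))), 0 ≤ f x) (g : ℝ → ℝ) :
    ∫ x, g x ∂profileMeasure f = ∫ x in Ioi 0, g x * f x := by
  rw [profileMeasure, integral_withDensity_eq_integral_toReal_smul₀
    hm.aemeasurable.ennreal_ofReal (ae_of_all _ fun x => ENNReal.ofReal_lt_top)]
  refine integral_congr_ae ?_
  filter_upwards [hn] with x hx
  rw [ENNReal.toReal_ofReal hx, smul_eq_mul, mul_comm]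

end Density

section Profile

variable {α ρ ε : ℝ} {W : ℝ → ℝ → ℝ} {f : ℝ → ℝ}

lemma IsProfile.aestronglyMeasurable {K : ℝ → ℝ → ℝ} (hf : IsProfile α ρ K f) :
    AEStronglyMeasurable f (volume.restrict (Ioi 0)) :=
  hf.locallyIntegrable.aestronglyMeasurable

lemma IsProfile.setLIntegral_Ioc {K : ℝ → ℝ → ℝ} (hf : IsProfile α ρ K f) (r : ℝ) :
    ∫⁻ x in Ioc 0 r, ENNReal.ofReal x ∂profileMeasure f =
      ENNReal.ofReal (∫ y in Ioc 0 r, y * f y) := by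
  have hi : IntegrableOn (fun x => x * f x) (Ioc 0 r) :=
    (hf.locallyIntegrable_mul.integrableOn_compact_subset Icc_subset_Ici_self
      (isCompact_Icc (a := 0) (b := r))).mono_set Ioc_subset_Icc_self
  have hn : ∀ᵐ x ∂(volume.restrict (Ioc 0 r)), 0 ≤ f x :=
    ae_restrict_of_ae_restrict_of_subset Ioc_subset_Ioi_self hf.nonneg
  rw [setLIntegral_profileMeasure hf.aestronglyMeasurable measurableSet_Ioc Ioc_subset_Ioi_self,
    ofReal_integral_eq_lintegral_ofReal hi]
  · refine lintegral_congr_ae ?_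
    filter_upwards [hn] with x hx
    rw [mul_comm, ENNReal.ofReal_mul' hx]
  · filter_upwards [hn, ae_restrict_mem measurableSet_Ioc] with x hx hx'
    exact mul_nonneg hx'.1.le hx

lemma IsProfile.hasTail {K : ℝ → ℝ → ℝ} (hρ : 0 < ρ) (hρ₁ : ρ < 1) (hf : IsProfile α ρ K f)
    (hN : IsNormalised ρ f) : HasTail ρ (profileMeasure f) := by
  have hG := Real.Gamma_pos_of_pos (show 0 < 2 - ρ by linarith)
  have hc : 0 < ρ ^ 2 / Real.Gamma (2 - ρ) := by positivity
  refine ⟨profileMeasure_pos f, fun r hr => ?_, fun η hη hη₁ => ?_⟩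
  · rw [hf.setLIntegral_Ioc]
    exact ENNReal.ofReal_le_ofReal (hN.le r hr)
  · have hv : ∀ᶠ R : ℝ in atTop, 0 < ρ ^ 2 / Real.Gamma (2 - ρ) * R ^ (1 - ρ) := by
      filter_upwards [Ioi_mem_atTop 0] with R hR
      exact mul_pos hc (Real.rpow_pos_of_pos hR _)
    have ht := (Asymptotics.isEquivalent_iff_tendsto_one (hv.mono fun _ h => h.ne')).1
      hN.isEquivalent
    have hev := (ht.eventually (lt_mem_nhds (show 1 - η < 1 by linarith))).and hv
    obtain ⟨R₀, hR₀⟩ := eventually_atTop.1 hev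
    have h1η : 0 ≤ 1 - η := by linarith
    have hM : 0 < max R₀ 1 := lt_max_of_lt_right one_pos
    -- Beyond R₀ the asymptotics suffice; below max R₀ 1 the additive constant, which is the
    -- left-hand side at that radius, dominates by itself.
    refine ⟨(1 - η) * (ρ ^ 2 / Real.Gamma (2 - ρ)) * (max R₀ 1) ^ (1 - ρ), by positivity,
      fun r hr => ?_⟩
    rcases le_total r (max R₀ 1) with hle | hle
    · refine le_add_left (ENNReal.ofReal_le_ofReal ?_)
      gcongr
    · refine le_add_right ?_
      obtain ⟨h1, h2⟩ := hR₀ r ((le_max_left _ _).trans hle)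
      rw [hf.setLIntegral_Ioc]
      refine ENNReal.ofReal_le_ofReal ?_
      rw [Pi.div_apply, lt_div_iff₀ h2] at h1
      linarith

/-- The perturbation, set to zero outside of the quadrant. -/
noncomputable def quadrantPart (W : ℝ → ℝ → ℝ) (y z : ℝ) : ℝ :=
  (Ioi (0 : ℝ) ×ˢ Ioi (0 : ℝ)).indicator (fun p => W p.1 p.2) (y, z)

lemma quadrantPart_eq {y z : ℝ} (hy : 0 < y) (hz : 0 < z) : quadrantPart W y z = W y z :=
  indicator_of_mem (mk_mem_prod hy hz) _

lemma IsPerturbation.quadrantPart_nonneg (hW : IsPerturbation α W) (y z : ℝ) :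
    0 ≤ quadrantPart W y z :=
  indicator_nonneg (fun p hp => hW.nonneg p.1 p.2 hp.1 hp.2) _

/-- W is continuous only on the open quadrant; extension by zero makes it Borel on the whole plane,
as Tonelli requires, without changing any integral. -/
lemma IsPerturbation.measurable_quadrantPart (hW : IsPerturbation α W) :
    Measurable (Function.uncurry (quadrantPart W)) := by
  classical
  have hs : MeasurableSet (Ioi (0 : ℝ) ×ˢ Ioi (0 : ℝ)) := measurableSet_Ioi.prod measurableSet_Ioi
  have := hW.continuousOn.measurable_piecewise (g := 0) continuousOn_const hs
  rwa [piecewise_eq_indicator] at this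

lemma IsProfile.flux_eq (hf : IsProfile α ρ (kernel ε W) f) (x : ℝ) :
    ∫⁻ y in Ioo 0 x, ∫⁻ z in Ioi (x - y), ENNReal.ofReal (y * kernel ε W y z * f y * f z) =
      ∫⁻ y in Ioo 0 x, ∫⁻ z in Ioi (x - y), ENNReal.ofReal (y * (2 + ε * quadrantPart W y z))
        ∂profileMeasure f ∂profileMeasure f := by
  have hm := hf.aestronglyMeasurable
  rw [setLIntegral_profileMeasure hm measurableSet_Ioo Ioo_subset_Ioi_self]
  refine lintegral_congr_ae ?_
  filter_upwards [ae_restrict_mem measurableSet_Ioo,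
    ae_restrict_of_ae_restrict_of_subset Ioo_subset_Ioi_self hf.nonneg] with y hy hfy
  have hsub : Ioi (x - y) ⊆ Ioi 0 := Ioi_subset_Ioi (by linarith [hy.2])
  rw [setLIntegral_profileMeasure hm measurableSet_Ioi hsub,
    ← lintegral_const_mul' _ _ ENNReal.ofReal_ne_top]
  refine lintegral_congr_ae ?_
  filter_upwards [ae_restrict_mem measurableSet_Ioi,
    ae_restrict_of_ae_restrict_of_subset hsub hf.nonneg] with z hz hfz
  rw [quadrantPart_eq hy.1 (hsub hz), ← ENNReal.ofReal_mul hfz, ← ENNReal.ofReal_mul hfy, kernel]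
  congr 1
  ring

/-- The self-similar equation in Laplace variables. -/
lemma IsProfile.laplace_equation (hW : IsPerturbation α W) (hε : 0 ≤ ε)
    (hf : IsProfile α ρ (kernel ε W) f) {q : ℝ} (hq : 0 < q) :
    ∫⁻ x, ENNReal.ofReal (x ^ 2 * Real.exp (-q * x)) ∂profileMeasure f =
      ENNReal.ofReal (1 - ρ) * (ENNReal.ofReal q⁻¹ *
        ∫⁻ x, ENNReal.ofReal (x * Real.exp (-q * x)) ∂profileMeasure f) +
      ENNReal.ofReal q⁻¹ * (2 * ((∫⁻ x, ENNReal.ofReal (x * Real.exp (-q * x)) ∂profileMeasure f) *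
        ∫⁻ x, ENNReal.ofReal (1 - Real.exp (-q * x)) ∂profileMeasure f) +
          ENNReal.ofReal ε * defect (quadrantPart W) (profileMeasure f) q) := by
  have hm := hf.aestronglyMeasurable
  have hpos := profileMeasure_pos f
  have hVm := hW.measurable_quadrantPart
  have hVy : ∀ y, Measurable (quadrantPart W y) := fun y => hVm.comp measurable_prodMk_left
  set V := quadrantPart W with hV
  set μ := profileMeasure f with hμ
  have hk : Measurable (Function.uncurry fun y z => ENNReal.ofReal (y * (2 + ε * V y z))) :=
    (measurable_fst.mul ((hVm.const_mul ε).const_add 2)).ennreal_ofReal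
  have hmono : Monotone fun x => ∫⁻ y in Ioo 0 x, ENNReal.ofReal y ∂μ := fun a b hab =>
    lintegral_mono_set (Ioo_subset_Ioo_right hab)
  have hsplit : ∫⁻ y, ∫⁻ z, ENNReal.ofReal (y * (2 + ε * V y z)) *
      ENNReal.ofReal (Real.exp (-q * y) * (1 - Real.exp (-q * z))) ∂μ ∂μ =
      2 * ((∫⁻ x, ENNReal.ofReal (x * Real.exp (-q * x)) ∂μ) *
        ∫⁻ x, ENNReal.ofReal (1 - Real.exp (-q * x)) ∂μ) + ENNReal.ofReal ε * defect V μ q := by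
    have hin : ∀ᵐ y ∂μ, ∫⁻ z, ENNReal.ofReal (y * (2 + ε * V y z)) *
        ENNReal.ofReal (Real.exp (-q * y) * (1 - Real.exp (-q * z))) ∂μ =
        2 * (ENNReal.ofReal (y * Real.exp (-q * y)) *
          ∫⁻ x, ENNReal.ofReal (1 - Real.exp (-q * x)) ∂μ) +
        ENNReal.ofReal ε * ∫⁻ z, ENNReal.ofReal (y * V y z) *
          ENNReal.ofReal (Real.exp (-q * y) * (1 - Real.exp (-q * z))) ∂μ := by
      filter_upwards [hpos] with y hy
      rw [← lintegral_const_mul' _ _ ENNReal.ofReal_ne_top,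
        ← lintegral_const_mul' _ _ ENNReal.ofReal_ne_top,
        ← lintegral_const_mul' _ _ ENNReal.ofNat_ne_top, ← lintegral_add_left (by fun_prop)]
      refine lintegral_congr fun z => ?_
      have hVn : 0 ≤ V y z := hW.quadrantPart_nonneg y z
      have h2 : ENNReal.ofReal (y * (2 + ε * V y z)) =
          2 * ENNReal.ofReal y + ENNReal.ofReal ε * ENNReal.ofReal (y * V y z) := by
        rw [← ENNReal.ofReal_mul hε, ← ENNReal.ofReal_ofNat 2,
          ← ENNReal.ofReal_mul (by norm_num),
          ← ENNReal.ofReal_add (by positivity) (by positivity)]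
        congr 1
        ring
      rw [h2, ENNReal.ofReal_mul (Real.exp_pos _).le,
        ENNReal.ofReal_mul (q := Real.exp _) hy.le]
      ring
    rw [lintegral_congr_ae hin, lintegral_add_left (by fun_prop),
      lintegral_const_mul' _ _ ENNReal.ofNat_ne_top, lintegral_mul_const _ (by fun_prop),
      lintegral_const_mul' _ _ ENNReal.ofReal_ne_top]
    rfl
  rw [← hsplit, ← lintegral_exp_mul_lintegral_Ioo hpos hq, ← lintegral_exp_mul_flux hpos hq hk,
    ← lintegral_const_mul' _ _ ENNReal.ofReal_ne_top, ← lintegral_add_left,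
    lintegral_profileMeasure hm]
  · refine lintegral_congr_ae ?_
    filter_upwards [hf.equation, hf.nonneg, ae_restrict_mem measurableSet_Ioi] with x hx hfx hx0
    have hx0' : 0 < x := hx0
    have h1 : ∫⁻ y in Ioo 0 x, ENNReal.ofReal (y * f y) = ∫⁻ y in Ioo 0 x, ENNReal.ofReal y ∂μ := by
      rw [setLIntegral_profileMeasure hm measurableSet_Ioo Ioo_subset_Ioi_self]
      refine lintegral_congr_ae ?_
      filter_upwards [ae_restrict_of_ae_restrict_of_subset Ioo_subset_Ioi_self hf.nonneg] with y hy
      rw [mul_comm y, ENNReal.ofReal_mul hy]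
    rw [SelfSimilarEqAt, hf.flux_eq x, h1] at hx
    have h2 : ENNReal.ofReal (f x) * ENNReal.ofReal (x ^ 2 * Real.exp (-q * x)) =
        ENNReal.ofReal (Real.exp (-q * x)) * ENNReal.ofReal (x ^ 2 * f x) := by
      rw [← ENNReal.ofReal_mul hfx, ← ENNReal.ofReal_mul (Real.exp_pos _).le]
      congr 1
      ring
    rw [h2, hx]
    ring
  · exact ((by fun_prop : Measurable fun x : ℝ => ENNReal.ofReal (Real.exp (-q * x))).mul
      hmono.measurable).const_mul _

lemma IsProfile.isRiccati (hρ : 0 < ρ) (hρ₁ : ρ < 1) (hW : IsPerturbation α W) (hε : 0 < ε)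
    (hf : IsProfile α ρ (kernel ε W) f) (hN : IsNormalised ρ f) :
    IsRiccati ρ (bernstein (profileMeasure f)) (mom (profileMeasure f) 1)
      (mom (profileMeasure f) 2)
      (fun q => ε * (defect (quadrantPart W) (profileMeasure f) q).toReal) := by
  have h := hf.hasTail hρ hρ₁ hN
  refine ⟨fun q hq => h.hasDerivAt_bernstein hρ hρ₁ hq, fun q hq => h.hasDerivAt_mom hρ₁ 0 hq,
    fun q hq => ?_, fun q hq => h.bernstein_nonneg hq.le, fun q hq => h.bernstein_le hρ hρ₁ hq,
    fun q _ => h.mom_nonneg 1 q, fun q hq => h.mom_one_le hρ₁ hq,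
    fun η hη hη₁ => h.le_mom_one hρ₁ hη hη₁,
    fun q _ => mul_nonneg hε.le ENNReal.toReal_nonneg⟩
  have heq := hf.laplace_equation hW hε.le hq
  have h2 : ∫⁻ x, ENNReal.ofReal (x ^ 2 * Real.exp (-q * x)) ∂profileMeasure f =
      ENNReal.ofReal (mom (profileMeasure f) 2 q) :=
    (ofReal_integral_eq_lintegral_ofReal (h.integrable_mom hρ₁ 1 hq)
      (h.mom_integrand_nonneg 2 q)).symm
  have h1 : ∫⁻ x, ENNReal.ofReal (x * Real.exp (-q * x)) ∂profileMeasure f =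
      ENNReal.ofReal (mom (profileMeasure f) 1 q) := by
    have := ofReal_integral_eq_lintegral_ofReal (h.integrable_mom hρ₁ 0 hq)
      (h.mom_integrand_nonneg 1 q)
    simp only [mom, zero_add, pow_one] at this ⊢
    exact this.symm
  have h0 : ∫⁻ x, ENNReal.ofReal (1 - Real.exp (-q * x)) ∂profileMeasure f =
      ENNReal.ofReal (bernstein (profileMeasure f) q) :=
    (ofReal_integral_eq_lintegral_ofReal (h.integrable_bernstein hρ hρ₁ hq)
      (h.bernstein_integrand_nonneg hq.le)).symm
  rw [h0, h1, h2] at heq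
  -- The left-hand side of the equation is a finite second moment and ε > 0, so the defect cannot be
  -- infinite. No estimate of W enters, and none relying on the mass bound would be available yet.
  have hfin : defect (quadrantPart W) (profileMeasure f) q ≠ ∞ := by
    intro htop
    have hq' : ENNReal.ofReal q⁻¹ ≠ 0 := by simpa using hq
    have hε' : ENNReal.ofReal ε ≠ 0 := by simpa using hε
    rw [htop, ENNReal.mul_top hε', add_top, ENNReal.mul_top hq', add_top] at heq
    exact ENNReal.ofReal_ne_top heq
  have hr := congrArg ENNReal.toReal heq
  rw [← ENNReal.ofReal_toReal hfin] at hr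
  have hm2 := h.mom_nonneg 2 q
  have hm1 := h.mom_nonneg 1 q
  have hb := h.bernstein_nonneg hq.le
  have hd : 0 ≤ (defect (quadrantPart W) (profileMeasure f) q).toReal := ENNReal.toReal_nonneg
  have h1ρ : 0 ≤ 1 - ρ := by linarith
  have hq' : 0 ≤ q⁻¹ := by positivity
  rw [← ENNReal.ofReal_ofNat 2, ← ENNReal.ofReal_mul hq', ← ENNReal.ofReal_mul h1ρ,
    ← ENNReal.ofReal_mul hm1, ← ENNReal.ofReal_mul zero_le_two, ← ENNReal.ofReal_mul hε.le,
    ← ENNReal.ofReal_add (by positivity) (by positivity), ← ENNReal.ofReal_mul hq',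
    ← ENNReal.ofReal_add (by positivity) (by positivity), ENNReal.toReal_ofReal hm2,
    ENNReal.toReal_ofReal (by positivity)] at hr
  rw [hr]
  field_simp
  ring

end Profile

/-! ### Finite mass, and decay and smoothness of the Laplace transform. -/

section Finite

variable {μ : Measure ℝ} {ρ : ℝ}

namespace HasTail

variable (h : HasTail ρ μ) [SFinite μ]
include h

/-- 1 - e^{-qx} increases to 1 as q → ∞ for each x > 0, so monotone convergence carries the bound on
the Bernstein function over to the mass. -/
lemma measure_univ_le (hρ : 0 < ρ) (hρ₁ : ρ < 1) (hU : ∀ q, 0 < q → bernstein μ q ≤ ρ) :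
    μ univ ≤ ENNReal.ofReal ρ := by
  have ht := lintegral_tendsto_of_tendsto_of_monotone (μ := μ)
    (f := fun (n : ℕ) x => ENNReal.ofReal (1 - Real.exp (-(n + 1 : ℝ) * x))) (F := fun _ => 1)
    (fun n => by fun_prop) ?_ ?_
  · rw [lintegral_one] at ht
    refine le_of_tendsto' ht fun n => ?_
    have hn : (0 : ℝ) < n + 1 := by positivity
    rw [← ofReal_integral_eq_lintegral_ofReal (h.integrable_bernstein hρ hρ₁ hn)
      (h.bernstein_integrand_nonneg hn.le)]
    exact ENNReal.ofReal_le_ofReal (hU _ hn)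
  · filter_upwards [h.pos] with x hx m n hmn
    have : (m : ℝ) ≤ n := by exact_mod_cast hmn
    refine ENNReal.ofReal_le_ofReal ?_
    gcongr
  · filter_upwards [h.pos] with x hx
    have h1 : Tendsto (fun n : ℕ => (n + 1 : ℝ) * x) atTop atTop :=
      (tendsto_natCast_atTop_atTop.atTop_add tendsto_const_nhds).atTop_mul_const hx
    have h2 : Tendsto (fun n : ℕ => 1 - Real.exp (-(n + 1 : ℝ) * x)) atTop (𝓝 (1 - 0)) := by
      refine (Real.tendsto_exp_atBot.comp (tendsto_neg_atTop_atBot.comp h1)).const_sub 1 |>.congr ?_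
      intro n
      simp only [Function.comp_apply, neg_mul]
    simpa using ENNReal.tendsto_ofReal h2

omit [SFinite μ] in
lemma norm_exp_le {q : ℝ} (hq : 0 ≤ q) : ∀ᵐ x ∂μ, ‖x ^ 0 * Real.exp (-q * x)‖ ≤ 1 := by
  filter_upwards [h.pos] with x hx
  rw [pow_zero, one_mul, Real.norm_of_nonneg (Real.exp_pos _).le]
  linarith [one_sub_exp_nonneg hq hx.le]

variable [IsFiniteMeasure μ]

omit [SFinite μ] in
lemma integrable_mom_zero {q : ℝ} (hq : 0 ≤ q) :
    Integrable (fun x => x ^ 0 * Real.exp (-q * x)) μ :=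
  (integrable_const (1 : ℝ)).mono' (by fun_prop) (h.norm_exp_le hq)

lemma integrable_mom' (hρ₁ : ρ < 1) (k : ℕ) {q : ℝ} (hq : 0 < q) :
    Integrable (fun x => x ^ k * Real.exp (-q * x)) μ := by
  cases k with
  | zero => exact h.integrable_mom_zero hq.le
  | succ k => exact h.integrable_mom hρ₁ k hq

omit [SFinite μ] in
lemma bernstein_eq {q : ℝ} (hq : 0 ≤ q) : bernstein μ q = μ.real univ - mom μ 0 q := by
  have hi := h.integrable_mom_zero hq
  simp only [pow_zero, one_mul] at hi
  simp only [bernstein, mom, pow_zero, one_mul]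
  rw [integral_sub (integrable_const _) hi]
  simp

omit [SFinite μ] in
lemma continuousOn_mom_zero : ContinuousOn (mom μ 0) (Ici 0) :=
  continuousOn_of_dominated (bound := fun _ => 1) (fun _ _ => by fun_prop)
    (fun _ hq => h.norm_exp_le hq) (integrable_const _) (ae_of_all _ fun x => by fun_prop)

omit [SFinite μ] in
lemma tendsto_mom_zero : Tendsto (mom μ 0) atTop (𝓝 0) := by
  have := tendsto_integral_filter_of_dominated_convergence (μ := μ) (l := atTop)
    (F := fun q x => x ^ 0 * Real.exp (-q * x)) (f := fun _ => (0 : ℝ)) (fun _ => 1)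
    (Eventually.of_forall fun q => by fun_prop) ?_ (integrable_const _) ?_
  · rwa [integral_zero] at this
  · filter_upwards [Ici_mem_atTop 0] with q hq using h.norm_exp_le hq
  · filter_upwards [h.pos] with x hx
    have h1 : Tendsto (fun q : ℝ => q * x) atTop atTop := tendsto_id.atTop_mul_const hx
    refine (Real.tendsto_exp_atBot.comp (tendsto_neg_atTop_atBot.comp h1)).congr ?_
    intro q
    simp only [Function.comp_apply, neg_mul, pow_zero, one_mul]

/-- From x e^{-qx/2} ≤ 2/q: each derivative gains a factor 1/q and halves the argument. -/
lemma mom_succ_le (hρ₁ : ρ < 1) (k : ℕ) {q : ℝ} (hq : 0 < q) :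
    mom μ (k + 1) q ≤ 2 / q * mom μ k (q / 2) := by
  have hq2 := half_pos hq
  rw [mom, mom, ← integral_const_mul]
  refine integral_mono_ae (h.integrable_mom hρ₁ k hq)
    ((h.integrable_mom' hρ₁ k hq2).const_mul _) ?_
  filter_upwards [h.pos] with x hx
  have hx' : 0 < x := hx
  calc x ^ (k + 1) * Real.exp (-q * x) =
      (x * Real.exp (-(q / 2) * x)) * (x ^ k * Real.exp (-(q / 2) * x)) := by
        rw [show -q * x = -(q / 2) * x + -(q / 2) * x by ring, Real.exp_add]; ring
    _ ≤ (q / 2)⁻¹ * (x ^ k * Real.exp (-(q / 2) * x)) := by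
        gcongr
        exact mul_exp_neg_le hq2 x
    _ = _ := by rw [inv_div]

/-- Identifies the limit of the energy at infinity as A² - ρA, with A the total mass. -/
lemma tendsto_mul_mom_one (hρ₁ : ρ < 1) : Tendsto (fun q => q * mom μ 1 q) atTop (𝓝 0) := by
  have h1 : Tendsto (fun q : ℝ => 2 * mom μ 0 (q / 2)) atTop (𝓝 0) := by
    simpa using (h.tendsto_mom_zero.comp
      ((tendsto_id (α := ℝ)).atTop_div_const two_pos)).const_mul 2
  refine squeeze_zero' ?_ ?_ h1
  · filter_upwards [Ioi_mem_atTop 0] with q hq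
    exact mul_nonneg (le_of_lt hq) (h.mom_nonneg 1 q)
  · filter_upwards [Ioi_mem_atTop 0] with q hq
    have hq' : 0 < q := hq
    calc q * mom μ 1 q ≤ q * (2 / q * mom μ 0 (q / 2)) := by
          gcongr; exact h.mom_succ_le hρ₁ 0 hq
      _ = _ := by field_simp

lemma hasDerivAt_mom' (hρ₁ : ρ < 1) (k : ℕ) {q : ℝ} (hq : 0 < q) :
    HasDerivAt (mom μ k) (-mom μ (k + 1) q) q := by
  have := hasDerivAt_integral_of_exp (φ := fun x => -x ^ (k + 1)) h.pos
    (fun s hs => h.integrable_mom' hρ₁ k hs)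
    (fun s hs => ((h.integrable_mom hρ₁ k hs).neg).congr (ae_of_all _ fun x => by
      simp)) (fun x s => ?_) hq
  · refine this.congr_deriv ?_
    simp only [mom, neg_mul, integral_neg]
  · refine ((hasDerivAt_exp_neg_mul x s).const_mul (x ^ k)).congr_deriv ?_
    ring

lemma contDiffOn_mom (hρ₁ : ρ < 1) (n k : ℕ) : ContDiffOn ℝ n (mom μ k) (Ioi 0) := by
  induction n generalizing k with
  | zero =>
    exact contDiffOn_zero.2 fun q hq =>
      (h.hasDerivAt_mom' hρ₁ k hq).continuousAt.continuousWithinAt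
  | succ n ih =>
    push_cast
    rw [contDiffOn_succ_iff_deriv_of_isOpen isOpen_Ioi]
    refine ⟨fun q hq => (h.hasDerivAt_mom' hρ₁ k hq).differentiableAt.differentiableWithinAt,
      fun hn => absurd hn (by simp), ?_⟩
    exact (ih (k + 1)).neg.congr fun q hq => (h.hasDerivAt_mom' hρ₁ k hq).deriv

lemma abs_iteratedDeriv_mom_zero (hρ₁ : ρ < 1) (n : ℕ) {q : ℝ} (hq : 0 < q) :
    |iteratedDeriv n (mom μ 0) q| = mom μ n q := by
  have key : iteratedDeriv n (mom μ 0) q = (-1) ^ n * mom μ n q := by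
    induction n generalizing q with
    | zero => simp
    | succ n ih =>
      have hev : iteratedDeriv n (mom μ 0) =ᶠ[𝓝 q] fun q => (-1) ^ n * mom μ n q := by
        filter_upwards [Ioi_mem_nhds hq] with s hs using ih hs
      rw [iteratedDeriv_succ, hev.deriv_eq, ((h.hasDerivAt_mom' hρ₁ n hq).const_mul _).deriv]
      ring
  rw [key, abs_mul, abs_pow, abs_neg, abs_one, one_pow, one_mul, abs_of_nonneg (h.mom_nonneg n q)]

end HasTail

end Finite

/-! ### The weighted norm. -/

section Norm

/-- Combination of a bound for small `q` and a bound for large `q`. -/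
lemma weight_mul_le {ρ θ ℓ a b g q : ℝ} (hρ : 0 < ρ) (hρ₁ : ρ < 1) (hθ₀ : 0 < θ) (hθ₁ : θ < 1)
    (ha : 0 ≤ a) (hb : 0 ≤ b) (hq : 0 < q) (h₁ : g ≤ a * q ^ (ρ - ℓ))
    (h₂ : g ≤ b * (q ^ (-ℓ) * (1 + q) ^ (-θ))) :
    (1 + q) ^ (θ + ρ) * q ^ (ℓ - ρ) * g ≤ 4 * a + 2 * b := by
  have hq1 : 0 < 1 + q := by linarith
  rcases le_total q 1 with hle | hle
  · have h3 : (1 + q) ^ (θ + ρ) ≤ 4 := by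
      calc (1 + q) ^ (θ + ρ) ≤ 2 ^ (θ + ρ) :=
            Real.rpow_le_rpow hq1.le (by linarith) (by linarith)
        _ ≤ 2 ^ (2 : ℝ) := Real.rpow_le_rpow_of_exponent_le (by norm_num) (by linarith)
        _ = 4 := by norm_num
    have h4 : q ^ (ℓ - ρ) * q ^ (ρ - ℓ) = 1 := by rw [← Real.rpow_add hq]; simp
    calc (1 + q) ^ (θ + ρ) * q ^ (ℓ - ρ) * g
        ≤ (1 + q) ^ (θ + ρ) * q ^ (ℓ - ρ) * (a * q ^ (ρ - ℓ)) := by gcongr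
      _ = (1 + q) ^ (θ + ρ) * a := by
        linear_combination (1 + q) ^ (θ + ρ) * a * h4
      _ ≤ 4 * a := by gcongr
      _ ≤ _ := by linarith
  · have h3 : ((1 + q) / q) ^ ρ ≤ 2 := by
      calc ((1 + q) / q) ^ ρ ≤ 2 ^ ρ := by
            refine Real.rpow_le_rpow (by positivity) ?_ hρ.le
            rw [div_le_iff₀ hq]; linarith
        _ ≤ 2 ^ (1 : ℝ) := Real.rpow_le_rpow_of_exponent_le (by norm_num) hρ₁.le
        _ = 2 := by norm_num
    calc (1 + q) ^ (θ + ρ) * q ^ (ℓ - ρ) * g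
        ≤ (1 + q) ^ (θ + ρ) * q ^ (ℓ - ρ) * (b * (q ^ (-ℓ) * (1 + q) ^ (-θ))) := by gcongr
      _ = ((1 + q) / q) ^ ρ * b := by
        have hqρ : 0 < q ^ ρ := Real.rpow_pos_of_pos hq _
        have hqℓ : 0 < q ^ ℓ := Real.rpow_pos_of_pos hq _
        have hqθ : 0 < (1 + q) ^ θ := Real.rpow_pos_of_pos hq1 _
        rw [Real.div_rpow hq1.le hq.le, Real.rpow_add hq1, Real.rpow_sub hq, Real.rpow_neg hq.le,
          Real.rpow_neg hq1.le]
        field_simp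
      _ ≤ 2 * b := by gcongr
      _ ≤ _ := by linarith

lemma one_add_half_rpow_le {θ q : ℝ} (hθ₀ : 0 < θ) (hθ₁ : θ < 1) (hq : 0 < q) :
    (1 + q / 2) ^ (-θ) ≤ 2 * (1 + q) ^ (-θ) := by
  have h1 : (1 + q / 2) ^ (-θ) ≤ ((1 + q) / 2) ^ (-θ) :=
    Real.rpow_le_rpow_of_nonpos (by linarith) (by linarith) (by linarith)
  have h2 : (2 : ℝ) ^ θ ≤ 2 := by
    calc (2 : ℝ) ^ θ ≤ 2 ^ (1 : ℝ) := Real.rpow_le_rpow_of_exponent_le (by norm_num) hθ₁.le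
      _ = 2 := by norm_num
  have h3 : ((1 + q) / 2) ^ (-θ) = 2 ^ θ * (1 + q) ^ (-θ) := by
    rw [Real.div_rpow (by linarith) (by norm_num), Real.rpow_neg (x := 2) (by norm_num)]
    field_simp
  have h4 : 0 < (1 + q) ^ (-θ) := Real.rpow_pos_of_pos (by linarith) _
  rw [h3] at h1
  nlinarith

/-- The weighted norm of the Laplace transform is controlled by its decay at infinity. -/
lemma HasTail.lfnorm_le {μ : Measure ℝ} {ρ θ B : ℝ} (h : HasTail ρ μ) [IsFiniteMeasure μ]
    (hρ : 0 < ρ) (hρ₁ : ρ < 1) (hθ₀ : 0 < θ) (hθ₁ : θ < 1) (hB : 0 ≤ B)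
    (hF : ∀ q, 0 < q → mom μ 0 q ≤ B * (1 + q) ^ (-θ)) :
    lfnorm ρ 2 0 θ (mom μ 0) ≤ ENNReal.ofReal (20 + 73 * B) := by
  have h1 : ∀ q, 0 < q → mom μ 1 q ≤ 4 * B * (q ^ (-1 : ℝ) * (1 + q) ^ (-θ)) := fun q hq => by
    calc mom μ 1 q ≤ 2 / q * mom μ 0 (q / 2) := h.mom_succ_le hρ₁ 0 hq
      _ ≤ 2 / q * (B * (2 * (1 + q) ^ (-θ))) := by
        gcongr
        exact (hF _ (half_pos hq)).trans (by gcongr; exact one_add_half_rpow_le hθ₀ hθ₁ hq)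
      _ = _ := by rw [Real.rpow_neg_one]; field_simp; ring
  have h2 : ∀ q, 0 < q → mom μ 2 q ≤ 32 * B * (q ^ (-2 : ℝ) * (1 + q) ^ (-θ)) := fun q hq => by
    calc mom μ 2 q ≤ 2 / q * mom μ 1 (q / 2) := h.mom_succ_le hρ₁ 1 hq
      _ ≤ 2 / q * (4 * B * ((q / 2) ^ (-1 : ℝ) * (2 * (1 + q) ^ (-θ)))) := by
        gcongr
        exact (h1 _ (half_pos hq)).trans (by gcongr; exact one_add_half_rpow_le hθ₀ hθ₁ hq)
      _ = _ := by
        rw [Real.rpow_neg_one, Real.rpow_neg hq.le, Real.rpow_two]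
        field_simp
        ring
  -- The decay bounds above only give q^(-ℓ) near 0, too weak for the weight q^(ℓ-ρ). The tail
  -- normalisation supplies q^(ρ-ℓ) there.
  have h1' : ∀ q, 0 < q → mom μ 1 q ≤ 1 * q ^ (ρ - 1) := fun q hq =>
    (h.mom_one_le hρ₁ hq).trans (by gcongr; nlinarith)
  have h2' : ∀ q, 0 < q → mom μ 2 q ≤ 4 * q ^ (ρ - 2) := fun q hq => by
    have h3 : (q / 2) ^ (ρ - 1) ≤ 2 * q ^ (ρ - 1) := by
      have : (2 : ℝ) ^ (1 - ρ) ≤ 2 := by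
        calc (2 : ℝ) ^ (1 - ρ) ≤ 2 ^ (1 : ℝ) :=
              Real.rpow_le_rpow_of_exponent_le (by norm_num) (by linarith)
          _ = 2 := by norm_num
      rw [Real.div_rpow hq.le (by norm_num), show ρ - 1 = -(1 - ρ) by ring,
        Real.rpow_neg (x := 2) (by norm_num), div_inv_eq_mul, mul_comm]
      gcongr
    calc mom μ 2 q ≤ 2 / q * mom μ 1 (q / 2) := h.mom_succ_le hρ₁ 1 hq
      _ ≤ 2 / q * (2 * q ^ (ρ - 1)) := by
        gcongr
        exact (h1' _ (half_pos hq)).trans (by rw [one_mul]; exact h3)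
      _ = 4 * q ^ (ρ - 2) := by
        rw [show ρ - 2 = ρ - 1 - 1 by ring, Real.rpow_sub_one hq.ne' (ρ - 1)]
        field_simp
        ring
  have e0 : lsnorm ρ 0 (-ρ) θ (mom μ 0) ≤ ENNReal.ofReal B := by
    refine iSup₂_le fun q hq => ENNReal.ofReal_le_ofReal ?_
    have hq1 : 0 < 1 + q := by linarith
    rw [h.abs_iteratedDeriv_mom_zero hρ₁ 0 hq]
    have : (1 + q) ^ (θ + -ρ + ρ) * q ^ (((0 : ℕ) : ℝ) - ρ - -ρ) = (1 + q) ^ θ := by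
      simp
    rw [this]
    calc (1 + q) ^ θ * mom μ 0 q ≤ (1 + q) ^ θ * (B * (1 + q) ^ (-θ)) := by gcongr; exact hF q hq
      _ = B := by
        rw [mul_left_comm, ← Real.rpow_add hq1]; simp
  have e1 : lsnorm ρ 1 0 θ (mom μ 0) ≤ ENNReal.ofReal (4 * 1 + 2 * (4 * B)) := by
    refine iSup₂_le fun q hq => ENNReal.ofReal_le_ofReal ?_
    rw [h.abs_iteratedDeriv_mom_zero hρ₁ 1 hq, add_zero, sub_zero, Nat.cast_one]
    exact weight_mul_le hρ hρ₁ hθ₀ hθ₁ zero_le_one (by positivity) hq (h1' q hq) (h1 q hq)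
  have e2 : lsnorm ρ 2 0 θ (mom μ 0) ≤ ENNReal.ofReal (4 * 4 + 2 * (32 * B)) := by
    refine iSup₂_le fun q hq => ENNReal.ofReal_le_ofReal ?_
    rw [h.abs_iteratedDeriv_mom_zero hρ₁ 2 hq, add_zero, sub_zero, Nat.cast_ofNat]
    exact weight_mul_le hρ hρ₁ hθ₀ hθ₁ (by norm_num) (by positivity) hq (h2' q hq) (h2 q hq)
  rw [lfnorm, if_neg two_ne_zero, show Finset.Icc 1 2 = {1, 2} from rfl,
    Finset.sum_pair (by norm_num)]
  calc _ ≤ _ := add_le_add e0 (add_le_add e1 e2)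
    _ = _ := by
      rw [← ENNReal.ofReal_add (by positivity) (by positivity),
        ← ENNReal.ofReal_add (by positivity) (by positivity)]
      congr 1
      ring

end Norm

/-! ### Uniform decay and conclusion. -/

lemma IsProfile.laplace_eq {α ρ : ℝ} {K : ℝ → ℝ → ℝ} {f : ℝ → ℝ} (hf : IsProfile α ρ K f) :
    laplace f = mom (profileMeasure f) 0 := by
  funext q
  simp only [laplace, mom, pow_zero, one_mul]
  rw [integral_profileMeasure hf.aestronglyMeasurable hf.nonneg]

lemma IsProfile.integrableOn {α ρ : ℝ} {K : ℝ → ℝ → ℝ} {f : ℝ → ℝ} (hf : IsProfile α ρ K f)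
    (hfin : profileMeasure f univ ≠ ∞) : IntegrableOn f (Ioi 0) := by
  refine (lintegral_ofReal_ne_top_iff_integrable hf.aestronglyMeasurable hf.nonneg).1 ?_
  have := lintegral_profileMeasure hf.aestronglyMeasurable (fun _ => 1)
  simp only [lintegral_one, mul_one] at this
  rwa [← this]

/-- Uniform decay of the Laplace transform of normalised profiles. -/
lemma exists_uniform_decay {α ρ θ : ℝ} {W : ℝ → ℝ → ℝ} (hα₀ : 0 ≤ α) (hαρ : α < ρ) (hρ₁ : ρ < 1)
    (hθ₀ : 0 < θ) (hθρ : θ < ρ) (hW : IsPerturbation α W) :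
    ∃ ε₀ : ℝ, 0 < ε₀ ∧ ∃ B : ℝ, 0 ≤ B ∧ ∀ ε : ℝ, 0 < ε → ε ≤ ε₀ → ∀ f : ℝ → ℝ,
      IsProfile α ρ (kernel ε W) f → IsNormalised ρ f → profileMeasure f univ ≠ ∞ ∧
        ∀ q, 0 < q → mom (profileMeasure f) 0 q ≤ B * (1 + q) ^ (-θ) := by
  have hρ : 0 < ρ := hα₀.trans_lt hαρ
  have hα₁ : α < 1 := hαρ.trans hρ₁
  have hαρ' : 0 < ρ - α := by linarith
  have hθρ' : 0 < ρ - θ := by linarith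
  set κ : ℝ := ρ * (1 - α) with hκdef
  have hκ : 0 < κ := mul_pos hρ (by linarith)
  set c : ℝ := 2 * ρ * (ρ ^ 2 * 2 ^ (1 + α - ρ)) * (1 + (ρ - α)⁻¹) with hcdef
  have hc : 0 < c := by positivity
  -- Chosen so that ρt/(1+t) = (3ρ+θ)/4: the explicit solution at q₀, where q₀^ρ = t, exceeds the
  -- required level (ρ+θ)/2 by (ρ-θ)/4.
  set t : ℝ := (3 * ρ + θ) / (ρ - θ) with htdef
  have ht : 0 < t := by positivity
  set q₀ : ℝ := t ^ ρ⁻¹ with hq₀def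
  have hq₀ : 0 < q₀ := Real.rpow_pos_of_pos ht _
  have hq₀t : q₀ ^ ρ = t := Real.rpow_inv_rpow ht.le hρ.ne'
  have hqκ : 0 < q₀ ^ κ := Real.rpow_pos_of_pos hq₀ _
  set K : ℝ := c / (ρ + κ) / κ * q₀ ^ κ * t with hKdef
  have hK : 0 < K := by positivity
  -- The perturbation lowers U(q₀) by at most εK, so this ε₀ uses up exactly that margin.
  refine ⟨(ρ - θ) / 4 / K, by positivity, ρ * (1 + q₀) ^ θ, by positivity, ?_⟩
  intro ε hε hε₀ f hf hN
  have hT := hf.hasTail hρ hρ₁ hN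
  have hR := hf.isRiccati hρ hρ₁ hW hε hN
  have hA := hT.measure_univ_le hρ hρ₁ fun q hq => hR.le_const hρ hρ₁ hq
  have hAfin : profileMeasure f univ ≠ ∞ := ne_top_of_le_ne_top ENNReal.ofReal_ne_top hA
  have : IsFiniteMeasure (profileMeasure f) := ⟨hAfin.lt_top⟩
  refine ⟨hAfin, fun q hq => ?_⟩
  have hE : ∀ q, 0 < q → ε * (defect (quadrantPart W) (profileMeasure f) q).toReal ≤
      ε * c * q ^ (ρ + κ - 1) := fun q hq => by
    rw [mul_assoc]
    gcongr
    refine ENNReal.toReal_le_of_le_ofReal (by positivity) ?_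
    exact hT.defect_le hρ hρ₁ hA hα₀ hαρ (fun y z hy hz => by
      rw [quadrantPart_eq hy hz]; exact hW.le y z hy hz) hq
  have hexp := hR.explicit_le hρ hρ₁ hκ hE hq₀
  have hU : (ρ + θ) / 2 ≤ bernstein (profileMeasure f) q₀ := by
    have hεK : ε * K ≤ (ρ - θ) / 4 := (le_div_iff₀ hK).1 hε₀
    have h1 := mul_le_mul_of_nonneg_right hexp ht.le
    rw [Real.rpow_neg hq₀.le, hq₀t] at h1
    have h2 : ρ / (1 + t) * t = (3 * ρ + θ) / 4 := by
      rw [htdef]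
      have : ρ - θ + (3 * ρ + θ) ≠ 0 := by linarith
      field_simp
      ring
    have h3 : (bernstein (profileMeasure f) q₀ * t⁻¹ + ε * c / (ρ + κ) / κ * q₀ ^ κ) * t =
        bernstein (profileMeasure f) q₀ + ε * K := by
      rw [hKdef]
      field_simp
    rw [h2, h3] at h1
    linarith
  have hlim : Tendsto (bernstein (profileMeasure f)) atTop (𝓝 ((profileMeasure f).real univ)) := by
    have h1 := hT.tendsto_mom_zero.const_sub ((profileMeasure f).real univ)
    rw [sub_zero] at h1
    refine h1.congr' ?_
    filter_upwards [Ici_mem_atTop 0] with s hs using (hT.bernstein_eq hs).symm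
  have hdec := hR.sub_le hρ hρ₁ hlim (hT.tendsto_mul_mom_one hρ₁) hq₀ hU hθ₀ hq
  rw [hT.bernstein_eq hq.le] at hdec
  linarith

end Coagulation

theorem proposition3p5 (α ρ θ : ℝ) (hα₀ : 0 ≤ α) (hα₁ : α < 1) (hαρ : α < ρ) (hρ₁ : ρ < 1)
    (hαθ : α < θ) (hθ : θ < min ρ (1 / 2)) (W : ℝ → ℝ → ℝ)
    (hW : Coagulation.IsPerturbation α W) :
    ∃ ε₀ : ℝ, 0 < ε₀ ∧ ∃ C : ℝ, 0 < C ∧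
      ∀ ε : ℝ, 0 < ε → ε ≤ ε₀ → ∀ f : ℝ → ℝ,
        Coagulation.IsProfile α ρ (Coagulation.kernel ε W) f →
        Coagulation.IsNormalised ρ f →
          MeasureTheory.IntegrableOn f (Set.Ioi 0) ∧
          Coagulation.lfnorm ρ 2 0 θ (Coagulation.laplace f) < ENNReal.ofReal C ∧
          Coagulation.laplace f ∈ Coagulation.spaceX ρ 2 0 θ := by
  have hρ : 0 < ρ := hα₀.trans_lt hαρ
  have hθ₀ : 0 < θ := hα₀.trans_lt hαθ
  have hθρ : θ < ρ := hθ.trans_le (min_le_left _ _)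
  have hθ₁ : θ < 1 := hθρ.trans hρ₁
  obtain ⟨ε₀, hε₀, B, hB, hdecay⟩ :=
    Coagulation.exists_uniform_decay hα₀ hαρ hρ₁ hθ₀ hθρ hW
  -- One more than the constant in `HasTail.lfnorm_le`, to make the inequality strict.
  refine ⟨ε₀, hε₀, 21 + 73 * B, by positivity, fun ε hε hle f hf hN => ?_⟩
  obtain ⟨hfin, hF⟩ := hdecay ε hε hle f hf hN
  have hT := hf.hasTail hρ hρ₁ hN
  have : IsFiniteMeasure (Coagulation.profileMeasure f) := ⟨hfin.lt_top⟩
  have hnorm := hT.lfnorm_le hρ hρ₁ hθ₀ hθ₁ hB hF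
  rw [hf.laplace_eq]
  refine ⟨hf.integrableOn hfin, hnorm.trans_lt ?_, hT.contDiffOn_mom hρ₁ 2 0,
    hT.continuousOn_mom_zero, hnorm.trans_lt ENNReal.ofReal_lt_top⟩
  exact (ENNReal.ofReal_lt_ofReal_iff (by positivity)).2 (by linarith)
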